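/- Let $\mathbb F\in\{\mathbb R,\mathbb C\}$, $T>0$, and let $g:\mathbb R\to\mathbb R$ be non-decreasing and left-continuous, with Lebesgue--Stieltjes measure $\mu_g$ ($\mu_g([c,d))=g(d)-g(c)$). Put $\Delta g(t)=g(t^+)-g(t)$, $D_g=\{t:\Delta g(t)>0\}$, and let $C_g=\bigcup_n(a_n,b_n)$ be the open set of points around which $g$ is constant, written as the disjoint union of its connected components; $N_g^-=\{a_n\}\setminus D_g$, $N_g^+=\{b_n\}\setminus D_g$, $N_g=N_g^-\cup N_g^+$. Assume $0\notin N_g^-$ and $T\notin N_g^+\cup D_g\cup C_g$. For $f:[0,T]\to\mathbb F$ the $g$-derivative is $f'_g(t)=\lim_{s\to t}\frac{f(s)-f(t)}{g(s)-g(t)}$ if $t\notin D_g\cup C_g$, the same limit with $s\to t^+$ if $t\in D_g$, and $f'_g(t)=\lim_{s\to b_n^+}\frac{f(s)-f(b_n)}{g(s)-g(b_n)}$ if $t\in(a_n,b_n)\subset C_g$ (limits over those $s\in[0,T]$ for which the quotient is defined). The function $f$ is $g$-continuous at $t$ if for every $\varepsilon>0$ there is $\delta>0$ with $|f(t)-f(s)|<\varepsilon$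 whenever $s\in[0,T]$, $|g(t)-g(s)|<\delta$; left (right) $g$-continuity is the same with $s<t$ ($s>t$) only. The space $\mathcal{BD}_g$ consists of the bounded $f:[0,T]\to\mathbb F$ that are $g$-continuous on $[0,T]\setminus(C_g\cup N_g\cup D_g)$, left $g$-continuous on $N_g^-$ and right $g$-continuous on $N_g^+$. The space $\mathcal{BD}^1_g$ consists of the $f\in\mathcal{BD}_g$ that are $g$-differentiable at every point of $[0,T]$ with $f'_g\in\mathcal{BD}_g$, and $\ker(\partial_g)=\{h\in\mathcal{BD}^1_g: h'_g=0 \text{ on } [0,T]\}$. A function $f:[0,T]\to\mathbb F$ is $g$-absolutely continuous if for every $\varepsilon>0$ there is $\delta>0$ such that $\sum_i|f(y_i)-f(x_i)|<\varepsilon$ for every finite family of pairwise disjoint open subintervals $(x_i,y_i)$ of $[0,T]$ with $\sum_i(g(y_i)-g(x_i))<\delta$; and $W^{1,1}_g$ is the space of $f\in L^1_g([0,T))$ for which there is $\tilde f\in L^1_g([0,T))$ with $f(y)-f(x)=\int_{[x,y)}\tilde f\,d\mu_g$ for $0\le x\le y\le T$. Let $\beta\in\mathcal{BD}_g$ be $g$-regressive,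 i.e. $1+\beta(t)\Delta g(t)\neq0$ for $t\in[0,T]\cap D_g$, and consider the problem $$v'_g(t)-\beta(t)v(t)=0\quad g\text{-a.e. } t\in[0,T),\qquad v(0)=1.\tag{1}$$ Then: 1. Problem (1) has exactly one $g$-absolutely continuous solution $v$. It belongs to $W^{1,1}_g\cap\mathcal{BD}^1_g$, and it is the $g$-exponential of $\beta$: $v(t)=\exp\left(\int_{[0,t)}\tilde\beta\,d\mu_g\right)$ for $t\in[0,T]$, where $\tilde\beta=\beta$ outside $D_g$ and $\tilde\beta=\ln(1+\beta\Delta g)/\Delta g$ on $D_g$ ($\ln$ the principal branch of the complex logarithm). 2. The solutions of (1) in $\mathcal{BD}^1_g$ are exactly the functions $h\cdot v$ with $h\in\ker(\partial_g)$ and $h(0)=1$. 3. Solutions in $\mathcal{BD}^1_g$ are in general not unique: if $g$ has a discontinuity in $(0,T)$, then (1) has a solution in $\mathcal{BD}^1_g$ different from $v$. -/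

import Mathlib

open Set Filter Topology MeasureTheory

/-- A derivator: a non-decreasing left-continuous function `g : ℝ → ℝ`. -/
structure Derivator where
  toFun : ℝ → ℝ
  monotone' : Monotone toFun
  leftCont' : ∀ t, ContinuousWithinAt toFun (Iic t) t

namespace Derivator

instance : CoeFun Derivator (fun _ => ℝ → ℝ) := ⟨Derivator.toFun⟩

/-- The jump `Δg(t) = g(t⁺) - g(t)`. -/
noncomputable def jump (g : Derivator) (t : ℝ) : ℝ := Function.rightLim g t - g t

/-- `D_g`, the set of discontinuity points of `g`. -/
def D (g : Derivator) : Set ℝ := {t | 0 < g.jump t}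

/-- `C_g`, the set of points around which `g` is constant. -/
def C (g : Derivator) : Set ℝ :=
  {t | ∃ ε > 0, ∃ c, ∀ s ∈ Ioo (t - ε) (t + ε), g s = c}

/-- `N_g⁻`: the (finite) left end points of the connected components of `C_g`
that are not in `D_g`. -/
def Nminus (g : Derivator) : Set ℝ :=
  {a | ∃ t ∈ g.C, IsGLB (connectedComponentIn g.C t) a} \ g.D

/-- `N_g⁺`: the (finite) right end points of the connected components of `C_g`
that are not in `D_g`. -/
def Nplus (g : Derivator) : Set ℝ :=
  {b | ∃ t ∈ g.C, IsLUB (connectedComponentIn g.C t) b} \ g.D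

/-- `N_g = N_g⁻ ∪ N_g⁺`. -/
def N (g : Derivator) : Set ℝ := g.Nminus ∪ g.Nplus

open Classical in
/-- `t* = t` outside `C_g`, and `t* = b` when `t` lies in the component `(a, b)` of `C_g`. -/
noncomputable def star (g : Derivator) (t : ℝ) : ℝ :=
  if t ∈ g.C then sSup (connectedComponentIn g.C t) else t

/-- The Lebesgue-Stieltjes measure `μ_g`, with `μ_g [c, d) = g d - g c` (see `measure_Ico`).
Mathlib builds it from the right-continuous modification of `g`. -/
noncomputable def measure (g : Derivator) : Measure ℝ := g.monotone'.stieltjesFunction.measure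

theorem measure_Ico (g : Derivator) (c d : ℝ) :
    g.measure (Ico c d) = ENNReal.ofReal (g d - g c) := by
  have key : ∀ x, Function.leftLim (g.monotone'.stieltjesFunction) x = g x := by
    intro x
    have h1 : Function.leftLim g.toFun x = g x :=
      leftLim_eq_of_tendsto
        ((g.leftCont' x).mono_left (nhdsWithin_mono _ Iio_subset_Iic_self))
    refine le_antisymm ?_ ?_
    · refine le_of_tendsto (g.monotone'.stieltjesFunction.mono.tendsto_leftLim x) ?_
      filter_upwards [self_mem_nhdsWithin] with y hy
      rw [Monotone.stieltjesFunction_eq]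
      exact (g.monotone'.rightLim_le_leftLim hy).trans h1.le
    · rw [← h1]
      refine le_of_tendsto_of_tendsto (g.monotone'.tendsto_leftLim x)
        (g.monotone'.stieltjesFunction.mono.tendsto_leftLim x) ?_
      filter_upwards with y
      rw [Monotone.stieltjesFunction_eq]
      exact g.monotone'.le_rightLim le_rfl
  rw [measure, StieltjesFunction.measure_Ico, key, key]

variable {𝕜 : Type*} [RCLike 𝕜]

/-- `f : [a, b] → 𝕜` has `g`-derivative `L` at `t ∈ [a, b]`. The limits are taken over those
`s ∈ [a, b]` for which the difference quotient is defined, that is `g s ≠ g t*`; they are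
one-sided, at `t*` from the right, when `t ∈ D_g ∪ C_g`. Only values of `f` on `[a, b]` matter
(provided that `b ∉ C_g`). -/
def HasDerivAt (g : Derivator) (a b : ℝ) (f : ℝ → 𝕜) (L : 𝕜) (t : ℝ) : Prop :=
  (t ∉ g.D ∪ g.C →
    Tendsto (fun s => (f s - f t) / ((g s - g t : ℝ) : 𝕜))
      (𝓝[{s | s ∈ Icc a b ∧ g s ≠ g t}] t) (𝓝 L)) ∧
  (t ∈ g.D ∪ g.C →
    Tendsto (fun s => (f s - f (g.star t)) / ((g s - g (g.star t) : ℝ) : 𝕜))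
      (𝓝[{s | s ∈ Icc a b ∧ g.star t < s ∧ g s ≠ g (g.star t)}] (g.star t)) (𝓝 L))

/-- `f : [a, b] → 𝕜` is `g`-continuous at `t`. -/
def ContAt (g : Derivator) (a b : ℝ) (f : ℝ → 𝕜) (t : ℝ) : Prop :=
  ∀ ε > 0, ∃ δ > 0, ∀ s ∈ Icc a b, |g t - g s| < δ → ‖f t - f s‖ < ε

/-- `f : [a, b] → 𝕜` is left `g`-continuous at `t`. -/
def LeftContAt (g : Derivator) (a b : ℝ) (f : ℝ → 𝕜) (t : ℝ) : Prop :=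
  ∀ ε > 0, ∃ δ > 0, ∀ s ∈ Icc a b, s < t → g t - g s < δ → ‖f s - f t‖ < ε

/-- `f : [a, b] → 𝕜` is right `g`-continuous at `t`. -/
def RightContAt (g : Derivator) (a b : ℝ) (f : ℝ → 𝕜) (t : ℝ) : Prop :=
  ∀ ε > 0, ∃ δ > 0, ∀ s ∈ Icc a b, t < s → g s - g t < δ → ‖f s - f t‖ < ε

/-- The space `BD_g([a, b]; 𝕜)`. -/
def MemBD (g : Derivator) (a b : ℝ) (f : ℝ → 𝕜) : Prop :=
  (∃ M : ℝ, ∀ t ∈ Icc a b, ‖f t‖ ≤ M) ∧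
  (∀ t ∈ Icc a b \ (g.C ∪ g.N ∪ g.D), g.ContAt a b f t) ∧
  (∀ t ∈ Icc a b ∩ g.Nminus, g.LeftContAt a b f t) ∧
  (∀ t ∈ Icc a b ∩ g.Nplus, g.RightContAt a b f t)

/-- The space `BD¹_g([a, b]; 𝕜)`: functions in `BD_g` that are `g`-differentiable at every point
of `[a, b]`, with `g`-derivative in `BD_g`. -/
def MemBD1 (g : Derivator) (a b : ℝ) (f : ℝ → 𝕜) : Prop :=
  g.MemBD a b f ∧
    ∃ f' : ℝ → 𝕜, (∀ t ∈ Icc a b, g.HasDerivAt a b f (f' t) t) ∧ g.MemBD a b f'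

/-- The kernel of `∂_g : BD¹_g([a, b]; 𝕜) → BD_g([a, b]; 𝕜)`, `h ↦ h'_g`. -/
def MemKer (g : Derivator) (a b : ℝ) (h : ℝ → 𝕜) : Prop :=
  g.MemBD1 a b h ∧ ∀ t ∈ Icc a b, g.HasDerivAt a b h 0 t

/-- `f` is `g`-absolutely continuous on `[a, b]`. -/
def AbsCont (g : Derivator) (a b : ℝ) (f : ℝ → 𝕜) : Prop :=
  ∀ ε > 0, ∃ δ > 0, ∀ (m : ℕ) (x y : Fin m → ℝ),
    (∀ i, a ≤ x i ∧ x i < y i ∧ y i ≤ b) →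
    (∀ i j, i ≠ j → Disjoint (Ioo (x i) (y i)) (Ioo (x j) (y j))) →
    ∑ i, (g (y i) - g (x i)) < δ → ∑ i, ‖f (y i) - f (x i)‖ < ε

/-- The Stieltjes-Sobolev space `W^{1,1}_g([a, b]; 𝕜)`. -/
def MemW11 (g : Derivator) (a b : ℝ) (f : ℝ → 𝕜) : Prop :=
  IntegrableOn f (Ico a b) g.measure ∧
    ∃ f' : ℝ → 𝕜, IntegrableOn f' (Ico a b) g.measure ∧
      ∀ x ∈ Icc a b, ∀ y ∈ Icc a b, x ≤ y → f y - f x = ∫ s in Ico x y, f' s ∂g.measure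

/-- `p` is `g`-regressive on `[a, b]`. -/
def Regressive (g : Derivator) (a b : ℝ) (p : ℝ → 𝕜) : Prop :=
  ∀ t ∈ Icc a b ∩ g.D, 1 + p t * ((g.jump t : ℝ) : 𝕜) ≠ 0

/-- `v` solves `v'_g = β v` `g`-a.e. in `[0, T)`, `v(0) = 1`. -/
def IsSolution (g : Derivator) (T : ℝ) (β v : ℝ → 𝕜) : Prop :=
  (∀ᵐ t ∂(g.measure.restrict (Ico 0 T)), g.HasDerivAt 0 T v (β t * v t) t) ∧ v 0 = 1

/-- The inclusion of `𝕜` (which is `ℝ` or `ℂ`) in `ℂ`. -/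
noncomputable def toComplex (z : 𝕜) : ℂ :=
  (RCLike.re z : ℂ) + (RCLike.im z : ℂ) * Complex.I

open Classical in
/-- The function `p̃` in the exponent of the `g`-exponential: `p` outside `D_g`, and
`ln(1 + p Δg) / Δg` on `D_g`, with the principal branch of the logarithm. -/
noncomputable def expIntegrand (g : Derivator) (p : ℝ → ℂ) (s : ℝ) : ℂ :=
  if s ∈ g.D then Complex.log (1 + p s * (g.jump s : ℂ)) / (g.jump s : ℂ) else p s

/-- The `g`-exponential `exp_g(p; t) = exp (∫_{[0,t)} p̃ dμ_g)`. -/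
noncomputable def gExp (g : Derivator) (p : ℝ → ℂ) (t : ℝ) : ℂ :=
  Complex.exp (∫ s in Ico 0 t, g.expIntegrand p s ∂g.measure)

end Derivator

/-! Everything rests on one comparison solution `v` that is Lipschitz with respect to `g` and
bounded away from zero. It is built as the exponential of a primitive `B` of `expIntegrand`. Off
`D_g` the usual chain rule applies. At a jump `B` increases by `log (1 + β Δg)`, so the exponential
is multiplied by `1 + β Δg`, which is what the equation demands (`hasDerivAt_gExp`). Uniqueness
among absolutely continuous functions follows by division. If `u` is another solution, `u / v` is
absolutely continuous and has derivative zero a.e. (`HasDerivAt.div_eq_zero`, where regressivity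
keeps the limiting denominator nonzero), and such functions are constant
(`AbsCont.eq_of_hasDerivAt_zero`). That last lemma is the analytic core: a Cousin argument lets a
function grow slowly at good points and confines the bad points to an open set of small measure,
where absolute continuity applies. It also shows that `v` is a primitive of `β v`, hence lies in
`W^{1,1}_g`. In `BD¹_g` an equation that holds a.e. holds everywhere off `C_g`, because both sides
are in `BD_g` (`MemBD.eq_zero_of_ae`). The quotient by `v` then lies in the kernel of the
derivative, and the product rule gives the converse. The kernel contains every step at a jump of `g`
(`memKer_step`), since neither `g`-continuity nor the right derivative at the jump detects it; this
destroys uniqueness. -/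

namespace Derivator

/-! ### Jumps, intervals of constancy and null sets of `g` -/

theorem jump_nonneg (g : Derivator) (t : ℝ) : 0 ≤ g.jump t :=
  sub_nonneg.2 (g.monotone'.le_rightLim le_rfl)

theorem jump_eq_zero {g : Derivator} {t : ℝ} (h : t ∉ g.D) : g.jump t = 0 :=
  le_antisymm (not_lt.1 h) (g.jump_nonneg t)

theorem tendsto_nhdsGT (g : Derivator) (t : ℝ) :
    Tendsto (fun s => g s - g t) (𝓝[>] t) (𝓝 (g.jump t)) :=
  (g.monotone'.tendsto_rightLim t).sub_const _

theorem continuousAt_of_notMem_D {g : Derivator} {t : ℝ} (h : t ∉ g.D) :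
    ContinuousAt g.toFun t := by
  refine continuousAt_iff_continuous_left_right.2 ⟨g.leftCont' t, ?_⟩
  rw [← continuousWithinAt_Ioi_iff_Ici]
  have := g.monotone'.tendsto_rightLim t
  have h0 : Function.rightLim g.toFun t = g t := by
    have := jump_eq_zero h
    unfold jump at this
    linarith
  rwa [h0] at this

theorem jump_le (g : Derivator) {t s : ℝ} (h : t < s) : g.jump t ≤ g s - g t :=
  sub_le_sub_right (g.monotone'.rightLim_le h) _

theorem countable_D (g : Derivator) : g.D.Countable := by
  refine Countable.mono (s₂ := {t | ¬ ContinuousAt g.toFun t}) (fun t ht hc => ?_)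
    g.monotone'.countable_not_continuousAt
  have h1 := g.tendsto_nhdsGT t
  have h2 : Tendsto (fun s => g s - g t) (𝓝[>] t) (𝓝 (g t - g t)) :=
    (hc.tendsto.mono_left nhdsWithin_le_nhds).sub_const _
  have := tendsto_nhds_unique h1 h2
  exact absurd this (by rw [sub_self]; exact ne_of_gt ht)

theorem isOpen_C (g : Derivator) : IsOpen g.C := by
  refine isOpen_iff_mem_nhds.2 ?_
  rintro t ⟨ε, hε, c, hc⟩
  refine mem_of_superset (Ioo_mem_nhds (show t - ε / 2 < t by linarith)
    (show t < t + ε / 2 by linarith)) fun s hs => ?_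
  refine ⟨ε / 2, by linarith, c, fun u hu => hc u ⟨?_, ?_⟩⟩
  · linarith [hu.1, hs.1]
  · linarith [hu.2, hs.2]

theorem measure_C (g : Derivator) : g.measure g.C = 0 := by
  refine measure_null_of_locally_null _ ?_
  rintro t ⟨ε, hε, c, hc⟩
  refine ⟨Ico (t - ε / 2) (t + ε / 2), mem_nhdsWithin_of_mem_nhds
    (Ico_mem_nhds (by linarith) (by linarith)), ?_⟩
  rw [measure_Ico, hc _ ⟨by linarith, by linarith⟩, hc _ ⟨by linarith, by linarith⟩]
  simp

theorem eq_of_Ico_subset_C {g : Derivator} {x y : ℝ} (hxy : x ≤ y) (h : Ico x y ⊆ g.C) :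
    g x = g y := by
  have h1 := measure_mono_null h g.measure_C
  rw [measure_Ico, ENNReal.ofReal_eq_zero] at h1
  exact le_antisymm (g.monotone' hxy) (by linarith)

theorem mem_C_of_eq {g : Derivator} {r t s : ℝ} (hr : r < t) (hs : t < s) (h : g r = g s) :
    t ∈ g.C := by
  refine ⟨min (t - r) (s - t), lt_min (by linarith) (by linarith), g r, fun u hu => ?_⟩
  have h1 : r ≤ u := by linarith [hu.1, min_le_left (t - r) (s - t)]
  have h2 : u ≤ s := by linarith [hu.2, min_le_right (t - r) (s - t)]
  exact le_antisymm ((g.monotone' h2).trans h.ge) (g.monotone' h1)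

theorem ordConnected_component (g : Derivator) (t : ℝ) :
    (connectedComponentIn g.C t).OrdConnected :=
  isPreconnected_connectedComponentIn.ordConnected

theorem isLUB_component {g : Derivator} {t b : ℝ} (ht : t ∈ g.C)
    (hb : IsLUB (connectedComponentIn g.C t) b) : t < b ∧ b ∉ g.C ∧ g b = g t := by
  have htK := mem_connectedComponentIn ht
  have hopen := g.isOpen_C.connectedComponentIn (x := t)
  have hnot : b ∉ connectedComponentIn g.C t := by
    intro h
    obtain ⟨u, hu, hu'⟩ := ((mem_nhdsGT_iff_exists_Ioo_subset).1
      (mem_nhdsWithin_of_mem_nhds (hopen.mem_nhds h)))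
    have := hb.1 (hu' ⟨show b < (b + u) / 2 by linarith [mem_Ioi.1 hu], by linarith [mem_Ioi.1 hu]⟩)
    linarith [mem_Ioi.1 hu]
  have hlt : t < b := lt_of_le_of_ne (hb.1 htK) (by rintro rfl; exact hnot htK)
  have hsub : Ico t b ⊆ connectedComponentIn g.C t := fun u hu => by
    obtain ⟨k, hk, hk'⟩ := (lt_isLUB_iff hb).1 hu.2
    exact (g.ordConnected_component t).out htK hk ⟨hu.1, hk'.le⟩
  refine ⟨hlt, fun hbC => ?_, ?_⟩
  · have h1 : Icc t b ⊆ g.C := fun u hu => by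
      rcases hu.2.lt_or_eq with h | h
      · exact connectedComponentIn_subset _ _ (hsub ⟨hu.1, h⟩)
      · exact h ▸ hbC
    exact hnot (isPreconnected_Icc.subset_connectedComponentIn (left_mem_Icc.2 hlt.le) h1
      (right_mem_Icc.2 hlt.le))
  · exact (eq_of_Ico_subset_C hlt.le (hsub.trans (connectedComponentIn_subset _ _))).symm

theorem isGLB_component {g : Derivator} {t a : ℝ} (ht : t ∈ g.C)
    (ha : IsGLB (connectedComponentIn g.C t) a) :
    a < t ∧ a ∉ g.C ∧ ∀ s ∈ Ioc a t, g s = g t := by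
  have htK := mem_connectedComponentIn ht
  have hopen := g.isOpen_C.connectedComponentIn (x := t)
  have hnot : a ∉ connectedComponentIn g.C t := by
    intro h
    obtain ⟨u, hu, hu'⟩ := ((mem_nhdsLT_iff_exists_Ioo_subset).1
      (mem_nhdsWithin_of_mem_nhds (hopen.mem_nhds h)))
    have := ha.1 (hu' ⟨show u < (a + u) / 2 by linarith [mem_Iio.1 hu], by linarith [mem_Iio.1 hu]⟩)
    linarith [mem_Iio.1 hu]
  have hlt : a < t := lt_of_le_of_ne (ha.1 htK) (by rintro rfl; exact hnot htK)
  have hsub : Ioc a t ⊆ connectedComponentIn g.C t := fun u hu => by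
    obtain ⟨k, hk, hk'⟩ := (isGLB_lt_iff ha).1 hu.1
    exact (g.ordConnected_component t).out hk htK ⟨hk'.le, hu.2⟩
  refine ⟨hlt, fun haC => ?_, fun s hs => ?_⟩
  · have h1 : Icc a t ⊆ g.C := fun u hu => by
      rcases hu.1.lt_or_eq with h | h
      · exact connectedComponentIn_subset _ _ (hsub ⟨h, hu.2⟩)
      · exact h ▸ haC
    exact hnot (isPreconnected_Icc.subset_connectedComponentIn (right_mem_Icc.2 hlt.le) h1
      (left_mem_Icc.2 hlt.le))
  · exact eq_of_Ico_subset_C hs.2 fun u hu =>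
      connectedComponentIn_subset _ _ (hsub ⟨hs.1.trans_le hu.1, hu.2.le⟩)

/-- Trades connected components for values of `g`: if `g` takes the same value at `s < t`, the whole
interval between lies in `C_g`, and conversely `g` keeps its value up to the right end point of a
component because `C_g` is null. -/
theorem mem_Nplus_iff {g : Derivator} {t : ℝ} :
    t ∈ g.Nplus ↔ t ∉ g.C ∧ t ∉ g.D ∧ ∃ s < t, g s = g t := by
  constructor
  · rintro ⟨⟨s, hs, hb⟩, hD⟩
    obtain ⟨h1, h2, h3⟩ := isLUB_component hs hb
    exact ⟨h2, hD, s, h1, h3.symm⟩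
  · rintro ⟨hC, hD, s, hst, hs⟩
    have hsub : Ioo s t ⊆ g.C := fun u hu => mem_C_of_eq hu.1 hu.2 hs
    have hm : (s + t) / 2 ∈ Ioo s t := ⟨by linarith, by linarith⟩
    refine ⟨⟨(s + t) / 2, hsub hm, fun k hk => ?_, fun k hk => ?_⟩, hD⟩
    · by_contra! hlt
      exact hC (connectedComponentIn_subset _ _ ((g.ordConnected_component _).out
        (mem_connectedComponentIn (hsub hm)) hk ⟨hm.2.le, hlt.le⟩))
    · have := isPreconnected_Ioo.subset_connectedComponentIn hm hsub
      exact (isLUB_Ioo hst).2 fun u hu => hk (this hu)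

/-- Unlike at a right end point, constancy on the component need not extend to its left end point;
it does so here because there is no jump. -/
theorem mem_Nminus_iff {g : Derivator} {t : ℝ} :
    t ∈ g.Nminus ↔ t ∉ g.C ∧ t ∉ g.D ∧ ∃ s > t, g s = g t := by
  constructor
  · rintro ⟨⟨s, hs, hb⟩, hD⟩
    obtain ⟨h1, h2, h3⟩ := isGLB_component hs hb
    refine ⟨h2, hD, s, h1, ?_⟩
    have h4 := g.tendsto_nhdsGT t
    rw [jump_eq_zero hD] at h4
    have h5 : Tendsto (fun s => g s - g t) (𝓝[>] t) (𝓝 (g s - g t)) := by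
      refine tendsto_const_nhds.congr' ?_
      filter_upwards [Ioc_mem_nhdsGT h1] with u hu
      rw [h3 u hu]
    exact sub_eq_zero.1 (tendsto_nhds_unique h5 h4)
  · rintro ⟨hC, hD, s, hst, hs⟩
    have hsub : Ioo t s ⊆ g.C := fun u hu => mem_C_of_eq hu.1 hu.2 hs.symm
    have hm : (t + s) / 2 ∈ Ioo t s := by
      have : t < s := hst
      exact ⟨by linarith, by linarith⟩
    refine ⟨⟨(t + s) / 2, hsub hm, fun k hk => ?_, fun k hk => ?_⟩, hD⟩
    · by_contra! hlt
      exact hC (connectedComponentIn_subset _ _ ((g.ordConnected_component _).out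
        hk (mem_connectedComponentIn (hsub hm)) ⟨hlt.le, hm.1.le⟩))
    · have := isPreconnected_Ioo.subset_connectedComponentIn hm hsub
      exact (isGLB_Ioo hst).2 fun u hu => hk (this hu)

theorem lt_of_notMem_Nminus {g : Derivator} {t s : ℝ} (hC : t ∉ g.C) (hN : t ∉ g.Nminus)
    (hs : t < s) : g t < g s := by
  refine lt_of_le_of_ne (g.monotone' hs.le) fun h => hN ?_
  refine mem_Nminus_iff.2 ⟨hC, fun hD => ?_, s, hs, h.symm⟩
  have := g.jump_le hs
  exact absurd (hD.trans_le this) (by rw [h]; simp)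

theorem lt_of_notMem_Nplus {g : Derivator} {t s : ℝ} (hC : t ∉ g.C) (hD : t ∉ g.D)
    (hN : t ∉ g.Nplus) (hs : s < t) : g s < g t :=
  lt_of_le_of_ne (g.monotone' hs.le) fun h => hN (mem_Nplus_iff.2 ⟨hC, hD, s, hs, h⟩)

theorem notMem_Nminus_of_mem_Nplus {g : Derivator} {t : ℝ} (h : t ∈ g.Nplus) :
    t ∉ g.Nminus := by
  intro h'
  obtain ⟨h1, _, s, h2, h3⟩ := mem_Nplus_iff.1 h
  obtain ⟨_, _, r, h4, h5⟩ := mem_Nminus_iff.1 h'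
  exact h1 (mem_C_of_eq h2 h4 (h3.trans h5.symm))

/-- Each point of `N_g` shares its value of `g` with another point, a monotone function has only
countably many such values, and `g` is injective on `N_g⁻` and on `N_g⁺`. -/
theorem countable_N (g : Derivator) : g.N.Countable := by
  have hc := g.monotone'.countable_setOfPred_two_preimages
  refine Countable.union ?_ ?_
  · refine MapsTo.countable_of_injOn (f := g.toFun) ?_ ?_ hc
    · intro t ht
      obtain ⟨_, _, s, hs, h⟩ := mem_Nminus_iff.1 ht
      exact ⟨t, s, hs, rfl, h⟩
    · intro x hx y hy hxy
      have key : ∀ x y, x ∈ g.Nminus → y ∈ g.Nminus → g x = g y → ¬ x < y := by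
        intro x y _ hy hxy hlt
        obtain ⟨h1, _, s, hs, h⟩ := mem_Nminus_iff.1 hy
        exact h1 (mem_C_of_eq hlt hs (hxy.trans h.symm))
      exact le_antisymm (not_lt.1 (key y x hy hx hxy.symm)) (not_lt.1 (key x y hx hy hxy))
  · refine MapsTo.countable_of_injOn (f := g.toFun) ?_ ?_ hc
    · intro t ht
      obtain ⟨_, _, s, hs, h⟩ := mem_Nplus_iff.1 ht
      exact ⟨s, t, hs, h, rfl⟩
    · intro x hx y hy hxy
      have key : ∀ x y, x ∈ g.Nplus → y ∈ g.Nplus → g x = g y → ¬ x < y := by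
        intro x y hx _ hxy hlt
        obtain ⟨h1, _, s, hs, h⟩ := mem_Nplus_iff.1 hx
        exact h1 (mem_C_of_eq hs hlt (h.trans hxy))
      exact le_antisymm (not_lt.1 (key y x hy hx hxy.symm)) (not_lt.1 (key x y hx hy hxy))

theorem notMem_D_of_mem_N {g : Derivator} {t : ℝ} (h : t ∈ g.N) : t ∉ g.D :=
  h.elim (fun h => (mem_Nminus_iff.1 h).2.1) fun h => (mem_Nplus_iff.1 h).2.1

theorem measure_singleton (g : Derivator) (t : ℝ) :
    g.measure {t} = ENNReal.ofReal (g.jump t) := by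
  have h1 : Tendsto (fun s => g.measure (Ico t s)) (𝓝[>] t) (𝓝 (g.measure {t})) := by
    have : {t} = ⋂ s > t, Ico t s := by
      ext u
      simp only [mem_singleton_iff, mem_iInter, mem_Ico]
      constructor
      · rintro rfl s hs
        exact ⟨le_rfl, hs⟩
      · intro h
        refine le_antisymm (le_of_forall_gt fun s hs => (h s hs).2) (h (t + 1) (by simp)).1
    rw [this]
    refine tendsto_measure_biInter_gt (fun _ _ => measurableSet_Ico.nullMeasurableSet)
      (fun i j _ hij => Ico_subset_Ico_right hij) ⟨t + 1, by simp, ?_⟩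
    rw [measure_Ico]
    exact ENNReal.ofReal_ne_top
  simp only [measure_Ico] at h1
  exact tendsto_nhds_unique h1 (ENNReal.tendsto_ofReal (g.tendsto_nhdsGT t))

theorem measure_singleton_eq_zero {g : Derivator} {t : ℝ} (h : t ∉ g.D) : g.measure {t} = 0 := by
  rw [measure_singleton, jump_eq_zero h, ENNReal.ofReal_zero]

theorem measure_N (g : Derivator) : g.measure g.N = 0 := by
  rw [← biUnion_of_singleton g.N, measure_biUnion_null_iff g.countable_N]
  exact fun t ht => measure_singleton_eq_zero (notMem_D_of_mem_N ht)

theorem measureReal_Ico (g : Derivator) {x y : ℝ} (h : x ≤ y) :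
    g.measure.real (Ico x y) = g y - g x := by
  rw [measureReal_def, measure_Ico, ENNReal.toReal_ofReal (sub_nonneg.2 (g.monotone' h))]

theorem star_of_notMem {g : Derivator} {t : ℝ} (h : t ∉ g.C) : g.star t = t := if_neg h

/-- Since `T ∉ C_g`, the component of `t` cannot pass `T`; it cannot end at `T` either, because its
end point lies in `D_g` or `N_g⁺`. -/
theorem star_spec {g : Derivator} {T t : ℝ} (hT : T ∉ g.Nplus ∪ g.D ∪ g.C) (ht : t ∈ g.C)
    (htT : t ≤ T) : t < g.star t ∧ g.star t ∉ g.C ∧ g (g.star t) = g t ∧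
      (g.star t ∈ g.D ∨ g.star t ∈ g.Nplus) ∧ g.star t < T := by
  have hTK : T ∈ upperBounds (connectedComponentIn g.C t) := fun k hk => by
    by_contra! hlt
    exact hT (Or.inr (connectedComponentIn_subset _ _ ((g.ordConnected_component _).out
      (mem_connectedComponentIn ht) hk ⟨htT, hlt.le⟩)))
  have hL : IsLUB (connectedComponentIn g.C t) (g.star t) := by
    rw [star, if_pos ht]
    exact isLUB_csSup ⟨t, mem_connectedComponentIn ht⟩ ⟨T, hTK⟩
  obtain ⟨h1, h2, h3⟩ := isLUB_component ht hL
  have h4 : g.star t ∈ g.D ∨ g.star t ∈ g.Nplus := by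
    by_cases hD : g.star t ∈ g.D
    · exact Or.inl hD
    · exact Or.inr (mem_Nplus_iff.2 ⟨h2, hD, t, h1, h3.symm⟩)
  refine ⟨h1, h2, h3, h4, lt_of_le_of_ne (hL.2 hTK) fun h => ?_⟩
  rw [h] at h4
  exact hT (Or.inl h4.symm)

theorem star_mem_Icc {g : Derivator} {T t : ℝ} (hT : T ∉ g.Nplus ∪ g.D ∪ g.C)
    (ht : t ∈ Icc 0 T) : g.star t ∈ Icc 0 T := by
  by_cases hC : t ∈ g.C
  · obtain ⟨h1, _, _, _, h2⟩ := star_spec hT hC ht.2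
    exact ⟨ht.1.trans h1.le, h2.le⟩
  · rwa [star_of_notMem hC]

theorem star_notMem_C {g : Derivator} {T t : ℝ} (hT : T ∉ g.Nplus ∪ g.D ∪ g.C)
    (ht : t ≤ T) : g.star t ∉ g.C := by
  by_cases hC : t ∈ g.C
  · exact (star_spec hT hC ht).2.1
  · rwa [star_of_notMem hC]

theorem apply_star {g : Derivator} {T t : ℝ} (hT : T ∉ g.Nplus ∪ g.D ∪ g.C)
    (ht : t ≤ T) : g (g.star t) = g t := by
  by_cases hC : t ∈ g.C
  · exact (star_spec hT hC ht).2.2.1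
  · rw [star_of_notMem hC]

/-! ### Calculus of the `g`-derivative -/

variable {𝕜 : Type*} [RCLike 𝕜]

/-- The filter along which the `g`-derivative at `t ∉ C_g` is taken. -/
def derivFilter (g : Derivator) (a b t : ℝ) : Filter ℝ :=
  𝓝[{s | s ∈ Icc a b ∧ (t ∈ g.D → t < s) ∧ g s ≠ g t}] t

theorem hasDerivAt_iff {g : Derivator} {a b t : ℝ} (ht : t ∉ g.C) {f : ℝ → 𝕜} {L : 𝕜} :
    g.HasDerivAt a b f L t ↔
      Tendsto (fun s => (f s - f t) / ((g s - g t : ℝ) : 𝕜)) (g.derivFilter a b t) (𝓝 L) := by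
  unfold HasDerivAt derivFilter
  by_cases hD : t ∈ g.D
  · simp [hD, star_of_notMem ht]
  · simp [hD, ht]

theorem hasDerivAt_of_star {g : Derivator} {a b t : ℝ} (ht : t ∈ g.C) (hs : g.star t ∉ g.C)
    {f : ℝ → 𝕜} {L : 𝕜} (h : g.HasDerivAt a b f L (g.star t)) : g.HasDerivAt a b f L t := by
  rw [hasDerivAt_iff hs] at h
  refine ⟨fun h' => absurd (Or.inr ht) h', fun _ => h.mono_left (nhdsWithin_mono _ ?_)⟩
  rintro s ⟨h1, h2, h3⟩
  exact ⟨h1, fun _ => h2, h3⟩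

theorem eventually_derivFilter_mem (g : Derivator) (a b t : ℝ) :
    ∀ᶠ s in g.derivFilter a b t, s ∈ Icc a b ∧ (t ∈ g.D → t < s) ∧ g s ≠ g t :=
  self_mem_nhdsWithin

theorem eventually_derivFilter_ne (g : Derivator) (a b t : ℝ) :
    ∀ᶠ s in g.derivFilter a b t, ((g s - g t : ℝ) : 𝕜) ≠ 0 := by
  filter_upwards [g.eventually_derivFilter_mem a b t] with s hs
  exact RCLike.ofReal_ne_zero.2 (sub_ne_zero.2 hs.2.2)

theorem tendsto_derivFilter (g : Derivator) (a b t : ℝ) :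
    Tendsto (fun s => g s - g t) (g.derivFilter a b t) (𝓝 (g.jump t)) := by
  by_cases hD : t ∈ g.D
  · exact (g.tendsto_nhdsGT t).mono_left (nhdsWithin_mono _ fun s hs => hs.2.1 hD)
  · have := (continuousAt_of_notMem_D hD).tendsto.sub_const (g t)
    rw [sub_self, ← jump_eq_zero hD] at this
    exact this.mono_left nhdsWithin_le_nhds

/-- Needed for uniqueness of derivatives. On the right `g` increases strictly unless `t ∈ N_g⁻` or
`t = T`; in these cases the assumptions at `0` and `T` ensure that it increases strictly on the
left. -/
theorem neBot_derivFilter {g : Derivator} {T t : ℝ} (hT : 0 < T) (hg0 : (0 : ℝ) ∉ g.Nminus)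
    (hgT : T ∉ g.Nplus ∪ g.D ∪ g.C) (ht : t ∈ Icc 0 T) (hC : t ∉ g.C) :
    NeBot (g.derivFilter 0 T t) := by
  by_cases h : t ∉ g.Nminus ∧ t < T
  · refine (left_nhdsWithin_Ioo_neBot h.2).mono (nhdsWithin_mono _ fun s hs => ?_)
    exact ⟨⟨ht.1.trans hs.1.le, hs.2.le⟩, fun _ => hs.1, (lt_of_notMem_Nminus hC h.1 hs.1).ne'⟩
  · have hD : t ∉ g.D := by
      intro hD
      refine h ⟨fun hN => notMem_D_of_mem_N (Or.inl hN) hD, lt_of_le_of_ne ht.2 ?_⟩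
      rintro rfl
      exact hgT (Or.inl (Or.inr hD))
    have hN : t ∉ g.Nplus := by
      intro hN
      refine h ⟨notMem_Nminus_of_mem_Nplus hN, lt_of_le_of_ne ht.2 ?_⟩
      rintro rfl
      exact hgT (Or.inl (Or.inl hN))
    have h0 : 0 < t := by
      refine lt_of_le_of_ne ht.1 ?_
      rintro rfl
      exact h ⟨hg0, hT⟩
    refine (right_nhdsWithin_Ioo_neBot h0).mono (nhdsWithin_mono _ fun s hs => ?_)
    exact ⟨⟨hs.1.le, hs.2.le.trans ht.2⟩, fun h => absurd h hD,
      (lt_of_notMem_Nplus hC hD hN hs.2).ne⟩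

theorem HasDerivAt.unique {g : Derivator} {a b t : ℝ} {f : ℝ → 𝕜} {L M : 𝕜} (hC : t ∉ g.C)
    (hF : NeBot (g.derivFilter a b t)) (hL : g.HasDerivAt a b f L t)
    (hM : g.HasDerivAt a b f M t) : L = M :=
  tendsto_nhds_unique ((hasDerivAt_iff hC).1 hL) ((hasDerivAt_iff hC).1 hM)

/-- A differentiable function need not be continuous at a jump; its limit there is shifted by the
derivative times the jump. This shift is the extra term in the product and quotient rules. -/
theorem HasDerivAt.tendsto {g : Derivator} {a b t : ℝ} {f : ℝ → 𝕜} {L : 𝕜} (hC : t ∉ g.C)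
    (hf : g.HasDerivAt a b f L t) :
    Tendsto f (g.derivFilter a b t) (𝓝 (f t + L * ((g.jump t : ℝ) : 𝕜))) := by
  have h1 := ((hasDerivAt_iff hC).1 hf).mul
    ((RCLike.continuous_ofReal.tendsto _).comp (g.tendsto_derivFilter a b t))
  refine (h1.const_add (f t)).congr' ?_
  filter_upwards [g.eventually_derivFilter_ne (𝕜 := 𝕜) a b t] with s hs
  simp only [Function.comp]
  rw [div_mul_cancel₀ _ hs, add_sub_cancel]

theorem HasDerivAt.mul {g : Derivator} {a b t : ℝ} {f h : ℝ → 𝕜} {L M : 𝕜} (hC : t ∉ g.C)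
    (hf : g.HasDerivAt a b f L t) (hh : g.HasDerivAt a b h M t) :
    g.HasDerivAt a b (fun s => f s * h s)
      (L * (h t + M * ((g.jump t : ℝ) : 𝕜)) + f t * M) t := by
  rw [hasDerivAt_iff hC]
  refine ((((hasDerivAt_iff hC).1 hf).mul (hh.tendsto hC)).add
    (((hasDerivAt_iff hC).1 hh).const_mul (f t))).congr fun s => ?_
  rw [div_mul_eq_mul_div, mul_div_assoc', ← add_div]
  congr 1
  ring

theorem HasDerivAt.sub {g : Derivator} {a b t : ℝ} {f h : ℝ → 𝕜} {L M : 𝕜} (hC : t ∉ g.C)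
    (hf : g.HasDerivAt a b f L t) (hh : g.HasDerivAt a b h M t) :
    g.HasDerivAt a b (fun s => f s - h s) (L - M) t := by
  rw [hasDerivAt_iff hC] at *
  refine (hf.sub hh).congr fun s => ?_
  rw [← sub_div]
  congr 1
  ring

/-- In the difference quotient of `u / v` the numerator tends to `p u v - u p v = 0` and the
denominator to `v(t)² (1 + p Δg(t))`. -/
theorem HasDerivAt.div_eq_zero {g : Derivator} {a b t : ℝ} {u v : ℝ → 𝕜} {p : 𝕜} (hC : t ∉ g.C)
    (hp : 1 + p * ((g.jump t : ℝ) : 𝕜) ≠ 0) (hv0 : v t ≠ 0)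
    (hu : g.HasDerivAt a b u (p * u t) t) (hv : g.HasDerivAt a b v (p * v t) t) :
    g.HasDerivAt a b (fun s => u s / v s) 0 t := by
  have hvt := hv.tendsto hC
  have hne : v t + p * v t * ((g.jump t : ℝ) : 𝕜) ≠ 0 := by
    have : v t + p * v t * ((g.jump t : ℝ) : 𝕜) = v t * (1 + p * ((g.jump t : ℝ) : 𝕜)) := by ring
    rw [this]
    exact mul_ne_zero hv0 hp
  rw [hasDerivAt_iff hC] at *
  have h1 := ((hu.mul_const (v t)).sub (hv.const_mul (u t))).div (hvt.mul_const (v t))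
    (mul_ne_zero hne hv0)
  have h2 : p * u t * v t - u t * (p * v t) = 0 := by ring
  rw [h2, zero_div] at h1
  refine h1.congr' ?_
  filter_upwards [hvt.eventually_ne hne, g.eventually_derivFilter_ne (𝕜 := 𝕜) a b t] with s hs hg
  simp only [Pi.div_apply]
  field_simp
  ring

theorem HasDerivAt.congr {g : Derivator} {a b t : ℝ} {f h : ℝ → 𝕜} {L : 𝕜} (hC : t ∉ g.C)
    (ht : t ∈ Icc a b) (hfh : EqOn f h (Icc a b)) (hf : g.HasDerivAt a b f L t) :
    g.HasDerivAt a b h L t := by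
  rw [hasDerivAt_iff hC] at *
  refine hf.congr' ?_
  filter_upwards [g.eventually_derivFilter_mem a b t] with s hs
  rw [hfh hs.1, hfh ht]

theorem HasDerivAt.clm {𝕜' : Type*} [RCLike 𝕜'] {g : Derivator} {a b t : ℝ} {f : ℝ → 𝕜} {L : 𝕜}
    (hC : t ∉ g.C) (A : 𝕜 →L[ℝ] 𝕜') (hf : g.HasDerivAt a b f L t) :
    g.HasDerivAt a b (fun s => A (f s)) (A L) t := by
  rw [hasDerivAt_iff hC] at *
  refine ((A.continuous.tendsto _).comp hf).congr fun s => ?_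
  simp only [Function.comp]
  rw [div_eq_inv_mul, ← RCLike.ofReal_inv, ← RCLike.real_smul_eq_coe_mul, map_smul, map_sub,
    RCLike.real_smul_eq_coe_mul, RCLike.ofReal_inv, ← div_eq_inv_mul]

/-! ### Lipschitz functions and the space `BD_g` -/

/-- `f` is Lipschitz with respect to `g` on `[a, b]`, with constant `K`. -/
def LipschitzWrt (g : Derivator) (a b K : ℝ) (f : ℝ → 𝕜) : Prop :=
  ∀ x ∈ Icc a b, ∀ y ∈ Icc a b, x ≤ y → ‖f y - f x‖ ≤ K * (g y - g x)

theorem LipschitzWrt.absCont {g : Derivator} {a b K : ℝ} {f : ℝ → 𝕜}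
    (hf : g.LipschitzWrt a b K f) : g.AbsCont a b f := by
  intro ε hε
  refine ⟨ε / (|K| + 1), by positivity, fun m x y hxy _ hsum => ?_⟩
  have h1 : ∑ i, ‖f (y i) - f (x i)‖ ≤ ∑ i, (|K| + 1) * (g (y i) - g (x i)) := by
    refine Finset.sum_le_sum fun i _ => ?_
    obtain ⟨h1, h2, h3⟩ := hxy i
    refine (hf _ ⟨h1, h2.le.trans h3⟩ _ ⟨h1.trans h2.le, h3⟩ h2.le).trans ?_
    exact mul_le_mul_of_nonneg_right (by linarith [le_abs_self K])
      (sub_nonneg.2 (g.monotone' h2.le))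
  rw [← Finset.mul_sum] at h1
  rw [lt_div_iff₀ (by positivity)] at hsum
  linarith

theorem LipschitzWrt.norm_sub_le {g : Derivator} {a b K : ℝ} {f : ℝ → 𝕜}
    (hf : g.LipschitzWrt a b K f) {s t : ℝ} (hs : s ∈ Icc a b) (ht : t ∈ Icc a b) :
    ‖f t - f s‖ ≤ |K| * |g t - g s| := by
  rw [← abs_mul]
  rcases le_total s t with h | h
  · exact (hf s hs t ht h).trans (le_abs_self _)
  · rw [norm_sub_rev, ← abs_neg]
    exact (hf t ht s hs h).trans (le_of_eq_of_le (by ring) (le_abs_self _))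

/-- The `g`-neighbourhoods of `t` in `[a, b] ∩ S`. -/
def contFilter (g : Derivator) (a b : ℝ) (S : Set ℝ) (t : ℝ) : Filter ℝ :=
  comap g.toFun (𝓝 (g t)) ⊓ 𝓟 (Icc a b ∩ S)

theorem tendsto_contFilter_iff {g : Derivator} {a b t : ℝ} {S : Set ℝ} {f : ℝ → 𝕜} {L : 𝕜} :
    Tendsto f (g.contFilter a b S t) (𝓝 L) ↔
      ∀ ε > 0, ∃ δ > 0, ∀ s ∈ Icc a b, s ∈ S → |g t - g s| < δ → ‖f s - L‖ < ε := by
  have hb := ((Metric.nhds_basis_ball (x := g t)).comap g.toFun).inf_principal (Icc a b ∩ S)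
  rw [contFilter, hb.tendsto_iff Metric.nhds_basis_ball]
  simp only [mem_inter_iff, mem_preimage, Metric.mem_ball, dist_eq_norm, Real.norm_eq_abs]
  refine forall₂_congr fun ε _ => exists_congr fun δ => and_congr_right fun _ => ?_
  refine forall_congr' fun s => ?_
  rw [abs_sub_comm]
  tauto

/-- With all three continuity conditions phrased as limits along filters, stability under products,
differences, inverses and continuous maps comes from the limit laws. -/
theorem memBD_iff {g : Derivator} {a b : ℝ} {f : ℝ → 𝕜} : g.MemBD a b f ↔
    (∃ M : ℝ, ∀ t ∈ Icc a b, ‖f t‖ ≤ M) ∧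
    (∀ t ∈ Icc a b \ (g.C ∪ g.N ∪ g.D), Tendsto f (g.contFilter a b univ t) (𝓝 (f t))) ∧
    (∀ t ∈ Icc a b ∩ g.Nminus, Tendsto f (g.contFilter a b (Iio t) t) (𝓝 (f t))) ∧
    (∀ t ∈ Icc a b ∩ g.Nplus, Tendsto f (g.contFilter a b (Ioi t) t) (𝓝 (f t))) := by
  simp only [tendsto_contFilter_iff]
  refine and_congr_right fun _ => and_congr ?_ (and_congr ?_ ?_)
  · refine forall₂_congr fun t _ => forall₂_congr fun ε _ => exists_congr fun δ =>
      and_congr_right fun _ => forall₂_congr fun s _ => ?_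
    rw [norm_sub_rev]
    simp
  · refine forall₂_congr fun t _ => forall₂_congr fun ε _ => exists_congr fun δ =>
      and_congr_right fun _ => forall₃_congr fun s _ hs => ?_
    rw [abs_of_nonneg (sub_nonneg.2 (g.monotone' (le_of_lt hs)))]
  · refine forall₂_congr fun t _ => forall₂_congr fun ε _ => exists_congr fun δ =>
      and_congr_right fun _ => forall₃_congr fun s _ hs => ?_
    rw [abs_sub_comm, abs_of_nonneg (sub_nonneg.2 (g.monotone' (le_of_lt hs)))]

theorem LipschitzWrt.memBD {g : Derivator} {a b K : ℝ} {f : ℝ → 𝕜}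
    (hf : g.LipschitzWrt a b K f) : g.MemBD a b f := by
  have key : ∀ t ∈ Icc a b, ∀ S, Tendsto f (g.contFilter a b S t) (𝓝 (f t)) := by
    intro t ht S
    refine tendsto_contFilter_iff.2 fun ε hε => ?_
    refine ⟨ε / (|K| + 1), by positivity, fun s hs _ h => ?_⟩
    rw [lt_div_iff₀ (by positivity)] at h
    rw [norm_sub_rev]
    refine (hf.norm_sub_le hs ht).trans_lt ?_
    nlinarith [abs_nonneg (g t - g s)]
  refine memBD_iff.2 ⟨⟨‖f a‖ + |K| * (g b - g a), fun t ht => ?_⟩, fun t ht => key t ht.1 _,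
    fun t ht => key t ht.1 _, fun t ht => key t ht.1 _⟩
  have ha : a ∈ Icc a b := ⟨le_rfl, ht.1.trans ht.2⟩
  have h1 := hf.norm_sub_le ha ht
  rw [abs_of_nonneg (sub_nonneg.2 (g.monotone' ht.1))] at h1
  have h2 : ‖f t‖ ≤ ‖f a‖ + ‖f t - f a‖ := norm_le_norm_add_norm_sub' _ _
  have h3 : |K| * (g t - g a) ≤ |K| * (g b - g a) :=
    mul_le_mul_of_nonneg_left (by linarith [g.monotone' ht.2]) (abs_nonneg _)
  linarith

theorem MemBD.mul {g : Derivator} {a b : ℝ} {f h : ℝ → 𝕜} (hf : g.MemBD a b f)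
    (hh : g.MemBD a b h) : g.MemBD a b (fun t => f t * h t) := by
  rw [memBD_iff] at *
  obtain ⟨⟨M, hM⟩, f1, f2, f3⟩ := hf
  obtain ⟨⟨M', hM'⟩, h1, h2, h3⟩ := hh
  refine ⟨⟨M * M', fun t ht => ?_⟩, fun t ht => (f1 t ht).mul (h1 t ht),
    fun t ht => (f2 t ht).mul (h2 t ht), fun t ht => (f3 t ht).mul (h3 t ht)⟩
  rw [norm_mul]
  exact mul_le_mul (hM t ht) (hM' t ht) (norm_nonneg _) ((norm_nonneg _).trans (hM t ht))

theorem MemBD.sub {g : Derivator} {a b : ℝ} {f h : ℝ → 𝕜} (hf : g.MemBD a b f)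
    (hh : g.MemBD a b h) : g.MemBD a b (fun t => f t - h t) := by
  rw [memBD_iff] at *
  obtain ⟨⟨M, hM⟩, f1, f2, f3⟩ := hf
  obtain ⟨⟨M', hM'⟩, h1, h2, h3⟩ := hh
  exact ⟨⟨M + M', fun t ht => (norm_sub_le _ _).trans (add_le_add (hM t ht) (hM' t ht))⟩,
    fun t ht => (f1 t ht).sub (h1 t ht),
    fun t ht => (f2 t ht).sub (h2 t ht), fun t ht => (f3 t ht).sub (h3 t ht)⟩

theorem memBD_const (g : Derivator) (a b : ℝ) (c : 𝕜) : g.MemBD a b (fun _ => c) :=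
  memBD_iff.2 ⟨⟨‖c‖, fun _ _ => le_rfl⟩, fun _ _ => tendsto_const_nhds,
    fun _ _ => tendsto_const_nhds, fun _ _ => tendsto_const_nhds⟩

theorem MemBD.comp_continuous {𝕜' : Type*} [RCLike 𝕜'] {g : Derivator} {a b : ℝ} {f : ℝ → 𝕜}
    (hf : g.MemBD a b f) {A : 𝕜 → 𝕜'} (hA : Continuous A) : g.MemBD a b (fun t => A (f t)) := by
  rw [memBD_iff] at *
  obtain ⟨⟨M, hM⟩, f1, f2, f3⟩ := hf
  obtain ⟨M', hM'⟩ := (isCompact_closedBall (0 : 𝕜) M).exists_bound_of_continuousOn hA.continuousOn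
  exact ⟨⟨M', fun t ht => hM' _ (by simpa using hM t ht)⟩,
    fun t ht => (hA.tendsto _).comp (f1 t ht),
    fun t ht => (hA.tendsto _).comp (f2 t ht), fun t ht => (hA.tendsto _).comp (f3 t ht)⟩

theorem MemBD.inv {g : Derivator} {a b c : ℝ} (hc : 0 < c) {f : ℝ → 𝕜} (hf : g.MemBD a b f)
    (hfc : ∀ t ∈ Icc a b, c ≤ ‖f t‖) : g.MemBD a b (fun t => (f t)⁻¹) := by
  have hne : ∀ t ∈ Icc a b, f t ≠ 0 := fun t ht => norm_pos_iff.1 (hc.trans_le (hfc t ht))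
  rw [memBD_iff] at *
  obtain ⟨_, f1, f2, f3⟩ := hf
  refine ⟨⟨c⁻¹, fun t ht => ?_⟩, fun t ht => (f1 t ht).inv₀ (hne t ht.1),
    fun t ht => (f2 t ht).inv₀ (hne t ht.1), fun t ht => (f3 t ht).inv₀ (hne t ht.1)⟩
  rw [norm_inv]
  exact inv_anti₀ hc (hfc t ht)

theorem MemBD.congr {g : Derivator} {a b : ℝ} {f h : ℝ → 𝕜} (hf : g.MemBD a b f)
    (hfh : EqOn f h (Icc a b)) : g.MemBD a b h := by
  have key : ∀ S t, t ∈ Icc a b → Tendsto f (g.contFilter a b S t) (𝓝 (f t)) →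
      Tendsto h (g.contFilter a b S t) (𝓝 (h t)) := by
    intro S t ht hT
    rw [← hfh ht]
    refine hT.congr' ?_
    filter_upwards [mem_inf_of_right (mem_principal_self _)] with s hs using hfh hs.1
  rw [memBD_iff] at *
  obtain ⟨⟨M, hM⟩, f1, f2, f3⟩ := hf
  exact ⟨⟨M, fun t ht => hfh ht ▸ hM t ht⟩, fun t ht => key _ t ht.1 (f1 t ht),
    fun t ht => key _ t ht.1 (f2 t ht), fun t ht => key _ t ht.1 (f3 t ht)⟩

/-- Passing from `t` to `t*` does not change `g`, so `g`-distances are preserved and only the side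
of the base point must be checked. On `C_g` the derivative is the one at `t*`, hence the need for
this composition. -/
theorem MemBD.comp_star {g : Derivator} {T : ℝ} (hgT : T ∉ g.Nplus ∪ g.D ∪ g.C) {f : ℝ → 𝕜}
    (hf : g.MemBD 0 T f) : g.MemBD 0 T (fun t => f (g.star t)) := by
  obtain ⟨⟨M, hM⟩, f1, f2, f3⟩ := hf
  refine ⟨⟨M, fun t ht => hM _ (star_mem_Icc hgT ht)⟩, fun t ht ε hε => ?_, fun t ht ε hε => ?_,
    fun t ht ε hε => ?_⟩
  · obtain ⟨δ, hδ, h⟩ := f1 t ht ε hε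
    refine ⟨δ, hδ, fun s hs hg => ?_⟩
    beta_reduce
    rw [star_of_notMem (fun hC => ht.2 (Or.inl (Or.inl hC)))]
    exact h _ (star_mem_Icc hgT hs) (by rwa [apply_star hgT hs.2])
  · have hC := (mem_Nminus_iff.1 ht.2).1
    obtain ⟨δ, hδ, h⟩ := f2 t ht ε hε
    refine ⟨δ, hδ, fun s hs hst hg => ?_⟩
    simp only [star_of_notMem hC]
    rcases lt_trichotomy (g.star s) t with h1 | h1 | h1
    · exact h _ (star_mem_Icc hgT hs) h1 (by rwa [apply_star hgT hs.2])
    · rwa [h1, sub_self, norm_zero]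
    · exact absurd (mem_C_of_eq hst h1 (apply_star hgT hs.2).symm) hC
  · have hC := (mem_Nplus_iff.1 ht.2).1
    obtain ⟨δ, hδ, h⟩ := f3 t ht ε hε
    refine ⟨δ, hδ, fun s hs hst hg => ?_⟩
    simp only [star_of_notMem hC]
    refine h _ (star_mem_Icc hgT hs) ?_ (by rwa [apply_star hgT hs.2])
    by_cases hsC : s ∈ g.C
    · exact hst.trans (star_spec hgT hsC hs.2).1
    · rwa [star_of_notMem hsC]

/-- Near `t`, the values of `f` on the intervals with end points `t` and `s` are close to `f t`. -/
def ContBetween (g : Derivator) (a b : ℝ) (f : ℝ → 𝕜) (t : ℝ) : Prop :=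
  ∀ ε > 0, ∀ᶠ s in g.derivFilter a b t,
    ∀ u ∈ Icc a b, u ∈ Ico (min s t) (max s t) → ‖f u - f t‖ ≤ ε

theorem eventually_derivFilter_abs_sub_lt {g : Derivator} {a b t : ℝ} (hD : t ∉ g.D) {δ : ℝ}
    (hδ : 0 < δ) : ∀ᶠ s in g.derivFilter a b t, |g s - g t| < δ := by
  have h := (g.tendsto_derivFilter a b t).abs
  rw [jump_eq_zero hD, abs_zero] at h
  exact h.eventually_lt_const hδ

theorem abs_sub_le_of_mem_Ico (g : Derivator) {s t u : ℝ} (hu : u ∈ Ico (min s t) (max s t)) :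
    |g u - g t| ≤ |g s - g t| := by
  rcases le_total s t with h | h
  · rw [min_eq_left h, max_eq_right h] at hu
    rw [abs_sub_comm, abs_sub_comm (g s), abs_of_nonneg (sub_nonneg.2 (g.monotone' hu.2.le)),
      abs_of_nonneg (sub_nonneg.2 (g.monotone' h))]
    linarith [g.monotone' hu.1]
  · rw [min_eq_right h, max_eq_left h] at hu
    rw [abs_of_nonneg (sub_nonneg.2 (g.monotone' hu.1)),
      abs_of_nonneg (sub_nonneg.2 (g.monotone' h))]
    linarith [g.monotone' hu.2.le]

/-- At a point of `N_g⁻` the difference quotient is undefined just to the right, and at a point of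
`N_g⁺` just to the left, so the one-sided continuity required by `BD_g` covers every relevant `s`.
-/
theorem MemBD.contBetween {g : Derivator} {a b t : ℝ} {f : ℝ → 𝕜} (hf : g.MemBD a b f)
    (ht : t ∈ Icc a b) (hC : t ∉ g.C) (hD : t ∉ g.D) : g.ContBetween a b f t := by
  intro ε hε
  obtain ⟨_, f1, f2, f3⟩ := hf
  by_cases hN : t ∈ g.N
  · rcases hN with hN | hN
    · obtain ⟨δ, hδ, h⟩ := f2 t ⟨ht, hN⟩ ε hε
      obtain ⟨_, _, r, hr, hrt⟩ := mem_Nminus_iff.1 hN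
      filter_upwards [eventually_derivFilter_abs_sub_lt hD hδ, g.eventually_derivFilter_mem a b t,
        mem_nhdsWithin_of_mem_nhds (Iio_mem_nhds hr)] with s hs hs' hsr u hu hus
      have hst : s < t := by
        by_contra! hts
        exact hs'.2.2 (le_antisymm (hrt ▸ g.monotone' (le_of_lt hsr)) (g.monotone' hts))
      have hgu := (g.abs_sub_le_of_mem_Ico hus).trans_lt hs
      rw [min_eq_left hst.le, max_eq_right hst.le] at hus
      rw [abs_sub_comm] at hgu
      exact (h u hu hus.2 ((le_abs_self _).trans_lt hgu)).le
    · obtain ⟨δ, hδ, h⟩ := f3 t ⟨ht, hN⟩ ε hε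
      obtain ⟨_, _, r, hr, hrt⟩ := mem_Nplus_iff.1 hN
      filter_upwards [eventually_derivFilter_abs_sub_lt hD hδ, g.eventually_derivFilter_mem a b t,
        mem_nhdsWithin_of_mem_nhds (Ioi_mem_nhds hr)] with s hs hs' hsr u hu hus
      have hst : t < s := by
        by_contra! hts
        exact hs'.2.2 (le_antisymm (g.monotone' hts) (hrt ▸ g.monotone' (le_of_lt hsr)))
      have hgu := (g.abs_sub_le_of_mem_Ico hus).trans_lt hs
      rw [min_eq_right hst.le, max_eq_left hst.le] at hus
      rcases hus.1.eq_or_lt with rfl | hlt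
      · simpa using hε.le
      · exact (h u hu hlt ((le_abs_self _).trans_lt hgu)).le
  · obtain ⟨δ, hδ, h⟩ := f1 t ⟨ht, by simp [hC, hN, hD]⟩ ε hε
    filter_upwards [eventually_derivFilter_abs_sub_lt hD hδ] with s hs u hu hus
    have hgu := (g.abs_sub_le_of_mem_Ico hus).trans_lt hs
    rw [norm_sub_rev]
    exact (h u hu (by rwa [abs_sub_comm])).le

/-! ### Absolutely continuous functions with vanishing derivative -/

/-- A form of Cousin's lemma: an additive relation between the end points of an interval that
holds locally on the left and on the right of every point holds globally. -/
theorem of_locally_of_additive {a b : ℝ} (hab : a ≤ b) {Q : ℝ → ℝ → Prop}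
    (hrefl : Q a a)
    (hadd : ∀ x y z, a ≤ x → x ≤ y → y ≤ z → z ≤ b → Q x y → Q y z → Q x z)
    (hleft : ∀ t ∈ Ioc a b, ∀ᶠ x in 𝓝[<] t, Q x t)
    (hright : ∀ t ∈ Ico a b, ∀ᶠ y in 𝓝[>] t, Q t y) : Q a b := by
  set S := {t | t ∈ Icc a b ∧ Q a t} with hS
  have hne : S.Nonempty := ⟨a, ⟨le_rfl, hab⟩, hrefl⟩
  have hbdd : BddAbove S := ⟨b, fun t ht => ht.1.2⟩
  have hlub := isLUB_csSup hne hbdd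
  set c := sSup S
  have hca : a ≤ c := hlub.1 ⟨⟨le_rfl, hab⟩, hrefl⟩
  have hcb : c ≤ b := hlub.2 fun t ht => ht.1.2
  have hcS : Q a c := by
    rcases hca.eq_or_lt with h | h
    · rw [← h]; exact hrefl
    · obtain ⟨l, hl, hl'⟩ := (mem_nhdsLT_iff_exists_Ioo_subset).1 (hleft c ⟨h, hcb⟩)
      obtain ⟨t, ht, hlt⟩ := (lt_isLUB_iff hlub).1 hl
      rcases (hlub.1 ht).eq_or_lt with h' | h'
      · rw [← h']; exact ht.2
      · exact hadd a t c le_rfl ht.1.1 h'.le hcb ht.2 (hl' ⟨hlt, h'⟩)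
  rcases hcb.eq_or_lt with h | h
  · rwa [← h]
  · obtain ⟨u, hu, hu'⟩ := (mem_nhdsGT_iff_exists_Ioo_subset).1 (hright c ⟨hca, h⟩)
    obtain ⟨y, hy, hy'⟩ := exists_between (lt_min hu h)
    have hyS : y ∈ S := ⟨⟨hca.trans hy.le, hy'.le.trans (min_le_right _ _)⟩,
      hadd a c y le_rfl hca hy.le (hy'.le.trans (min_le_right _ _)) hcS
        (hu' ⟨hy, hy'.trans_le (min_le_left _ _)⟩)⟩
    exact absurd (hlub.1 hyS) (not_le.2 hy)

theorem AbsCont.exists_norm_sub_lt {g : Derivator} {a b : ℝ} {f : ℝ → 𝕜} (hf : g.AbsCont a b f)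
    {ε : ℝ} (hε : 0 < ε) : ∃ δ > 0, ∀ x y, a ≤ x → x ≤ y → y ≤ b → g y - g x < δ →
      ‖f y - f x‖ < ε := by
  obtain ⟨δ, hδ, h⟩ := hf ε hε
  refine ⟨δ, hδ, fun x y hx hxy hy hg => ?_⟩
  rcases hxy.eq_or_lt with rfl | hlt
  · simpa using hε
  · have := h 1 (fun _ => x) (fun _ => y) (fun _ => ⟨hx, hlt, hy⟩)
      (fun i j hij => absurd (Subsingleton.elim i j) hij) (by simpa using hg)
    simpa using this

theorem AbsCont.eq_of_eq {g : Derivator} {a b : ℝ} {f : ℝ → 𝕜} (hf : g.AbsCont a b f) {x y : ℝ}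
    (hx : x ∈ Icc a b) (hy : y ∈ Icc a b) (h : g x = g y) : f x = f y := by
  wlog hxy : x ≤ y generalizing x y
  · exact (this hy hx h.symm (le_of_not_ge hxy)).symm
  refine (sub_eq_zero.1 (norm_le_zero_iff.1 (le_of_forall_pos_lt_add fun ε hε => ?_))).symm
  obtain ⟨δ, hδ, hd⟩ := hf.exists_norm_sub_lt hε
  rw [zero_add]
  exact hd x y hx.1 hxy hy.2 (by rw [h, sub_self]; exact hδ)

/-- There are finitely many disjoint subintervals of `[x, y]` such that `f` grows by at most
`ε (g y - g x)` plus its total growth over them, and their total length is bounded by the measure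
of `U ∩ [x, y)`. -/
def GrowthBound (g : Derivator) (f : ℝ → 𝕜) (U : Set ℝ) (ε x y : ℝ) : Prop :=
  ∃ (m : ℕ) (X Y : Fin m → ℝ), (∀ i, x ≤ X i ∧ X i < Y i ∧ Y i ≤ y) ∧
    (∀ i j, i ≠ j → Disjoint (Ioo (X i) (Y i)) (Ioo (X j) (Y j))) ∧
    ∑ i, (g (Y i) - g (X i)) ≤ g.measure.real (U ∩ Ico x y) ∧
    ‖f y - f x‖ ≤ ε * (g y - g x) + ∑ i, ‖f (Y i) - f (X i)‖

theorem growthBound_of_le {g : Derivator} {f : ℝ → 𝕜} {U : Set ℝ} {ε x y : ℝ}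
    (h : ‖f y - f x‖ ≤ ε * (g y - g x)) : g.GrowthBound f U ε x y :=
  ⟨0, Fin.elim0, Fin.elim0, fun i => i.elim0, fun i => i.elim0, by simp, by simpa using h⟩

theorem growthBound_of_subset {g : Derivator} {f : ℝ → 𝕜} {U : Set ℝ} {ε x y : ℝ} (hε : 0 ≤ ε)
    (hxy : x < y) (h : Ico x y ⊆ U) : g.GrowthBound f U ε x y := by
  refine ⟨1, fun _ => x, fun _ => y, fun _ => ⟨le_rfl, hxy, le_rfl⟩,
    fun i j hij => absurd (Subsingleton.elim i j) hij, ?_, ?_⟩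
  · rw [inter_eq_right.2 h, g.measureReal_Ico hxy.le]
    simp
  · have := mul_nonneg hε (sub_nonneg.2 (g.monotone' hxy.le))
    simpa using this

theorem GrowthBound.trans {g : Derivator} {f : ℝ → 𝕜} {U : Set ℝ} (hU : MeasurableSet U)
    {ε x y z : ℝ} (hxy : x ≤ y) (hyz : y ≤ z)
    (h1 : g.GrowthBound f U ε x y) (h2 : g.GrowthBound f U ε y z) : g.GrowthBound f U ε x z := by
  obtain ⟨m, X, Y, hX, hd, hs, hf⟩ := h1
  obtain ⟨n, X', Y', hX', hd', hs', hf'⟩ := h2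
  have hcross : ∀ i j, Disjoint (Ioo (X i) (Y i)) (Ioo (X' j) (Y' j)) := fun i j =>
    disjoint_left.2 fun u hu hu' => by
      linarith [hu.2, hu'.1, (hX i).2.2, (hX' j).1]
  refine ⟨m + n, Fin.append X X', Fin.append Y Y', fun i => ?_, fun i j => ?_, ?_, ?_⟩
  · refine Fin.addCases (fun i => ?_) (fun i => ?_) i
    · simpa using ⟨(hX i).1, (hX i).2.1, (hX i).2.2.trans hyz⟩
    · simpa using ⟨hxy.trans (hX' i).1, (hX' i).2.1, (hX' i).2.2⟩
  · refine Fin.addCases (fun i => ?_) (fun i => ?_) i <;>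
      refine Fin.addCases (fun j => ?_) (fun j => ?_) j
    · intro hij
      simpa only [Fin.append_left] using hd i j (by rintro rfl; exact hij rfl)
    · intro _
      simpa only [Fin.append_left, Fin.append_right] using hcross i j
    · intro _
      simpa only [Fin.append_left, Fin.append_right] using (hcross j i).symm
    · intro hij
      simpa only [Fin.append_right] using hd' i j (by rintro rfl; exact hij rfl)
  · have hfin : ∀ x y, g.measure (U ∩ Ico x y) ≠ ⊤ := fun x y =>
      ne_top_of_le_ne_top (by rw [measure_Ico]; exact ENNReal.ofReal_ne_top)
        (measure_mono (inter_subset_right (s := U) (t := Ico x y)))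
    have hu : U ∩ Ico x z = (U ∩ Ico x y) ∪ (U ∩ Ico y z) := by
      rw [← inter_union_distrib_left, Ico_union_Ico_eq_Ico hxy hyz]
    rw [hu, measureReal_union _ (hU.inter measurableSet_Ico) (hfin _ _) (hfin _ _), Fin.sum_univ_add]
    · simpa using add_le_add hs hs'
    · exact disjoint_left.2 fun u hu hu' => by linarith [hu.2.2, hu'.2.1]
  · rw [Fin.sum_univ_add]
    simp only [Fin.append_left, Fin.append_right]
    have : f z - f x = (f y - f x) + (f z - f y) := by ring
    rw [this]
    refine (norm_add_le _ _).trans ?_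
    linarith

/-- At a jump the derivative controls the right side only, so the left side must be absorbed in a
set of small measure. This is possible because `D_g` is countable and, by left continuity, the
intervals `(l, t)`, which omit the atom `t`, have measure tending to zero. -/
theorem exists_isOpen_measure_le (g : Derivator) {δ : ENNReal} (hδ : 0 < δ) :
    ∃ U, IsOpen U ∧ g.measure U < δ ∧ ∀ t ∈ g.D, ∀ᶠ x in 𝓝[<] t, Ico x t ⊆ U := by
  have := g.countable_D.to_subtype
  obtain ⟨ε', hε', hsum⟩ := ENNReal.exists_pos_sum_of_countable' hδ.ne' g.D
  have hη : ∀ t : g.D, ∃ l < (t : ℝ), g.measure (Ioo l t) ≤ ε' t := by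
    intro t
    have h1 : Tendsto (fun s => ENNReal.ofReal (g t - g s)) (𝓝[<] (t : ℝ)) (𝓝 0) := by
      have h2 : Tendsto g.toFun (𝓝[<] (t : ℝ)) (𝓝 (g t)) :=
        (g.leftCont' t).mono_left (nhdsWithin_mono _ Iio_subset_Iic_self)
      have := ENNReal.tendsto_ofReal (h2.const_sub (g t))
      simpa using this
    obtain ⟨l, hl, hl'⟩ := ((h1.eventually_lt_const (hε' t)).and self_mem_nhdsWithin).exists
    refine ⟨l, hl', (measure_mono Ioo_subset_Ico_self).trans ?_⟩
    rw [measure_Ico]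
    exact hl.le
  choose l hl hl' using hη
  refine ⟨⋃ t : g.D, Ioo (l t) t, isOpen_iUnion fun _ => isOpen_Ioo,
    (measure_iUnion_le _).trans_lt ((ENNReal.tsum_le_tsum hl').trans_lt hsum), fun t ht => ?_⟩
  filter_upwards [Ioo_mem_nhdsLT (hl ⟨t, ht⟩)] with x hx u hu
  exact mem_iUnion.2 ⟨⟨t, ht⟩, hx.1.trans_le hu.1, hu.2⟩

/-- Around each point either `f` grows by at most `ε₁` times the growth of `g`, or the interval lies
in an open set `U` of measure below `δ`. Cousin's lemma patches this into a bound on `[0, c]`, and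
absolute continuity makes the contribution of `U` less than `ε / 2`. -/
theorem AbsCont.eq_of_hasDerivAt_zero {g : Derivator} {T : ℝ} (hTD : T ∉ g.D) {f : ℝ → 𝕜}
    (hf : g.AbsCont 0 T f)
    (hd : ∀ᵐ t ∂(g.measure.restrict (Ico 0 T)), g.HasDerivAt 0 T f 0 t) {c : ℝ}
    (hc : c ∈ Icc 0 T) : f c = f 0 := by
  refine sub_eq_zero.1 (norm_le_zero_iff.1 (le_of_forall_pos_le_add fun ε hε => ?_))
  have hgc : 0 ≤ g c - g 0 := sub_nonneg.2 (g.monotone' hc.1)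
  -- Chosen so that slow growth over all of `[0, c]` costs at most `ε / 2`; the `+ 1` guards against
  -- `g c = g 0`.
  set ε₁ := ε / 2 / (g c - g 0 + 1) with hε₁
  have hε₁0 : 0 < ε₁ := by positivity
  obtain ⟨δ, hδ, hac⟩ := hf (ε / 2) (by positivity)
  obtain ⟨U₁, hU₁, hU₁m, hU₁D⟩ := g.exists_isOpen_measure_le
    (ENNReal.ofReal_pos.2 (half_pos hδ))
  -- `T` is included because differentiability is assumed on `[0, T)` only, and `C_g` because the
  -- derivative there describes `t*` instead of `t`. Both are null.
  set E := {t | t ∈ Ico 0 T ∧ ¬ g.HasDerivAt 0 T f 0 t} ∪ ({T} ∪ g.C) with hE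
  have hE0 : g.measure E = 0 := by
    rw [ae_restrict_iff' measurableSet_Ico, ae_iff] at hd
    refine measure_union_null ?_ (measure_union_null (measure_singleton_eq_zero hTD) g.measure_C)
    convert hd using 2
    ext t
    simp [and_assoc]
  have : IsLocallyFiniteMeasure g.measure := by unfold measure; infer_instance
  obtain ⟨U₂, hU₂E, hU₂, hU₂m⟩ := E.exists_isOpen_lt_of_lt (μ := g.measure)
    (ENNReal.ofReal (δ / 2)) (by rw [hE0]; exact ENNReal.ofReal_pos.2 (half_pos hδ))
  set U := U₁ ∪ U₂ with hUdef
  have hUo : IsOpen U := hU₁.union hU₂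
  have hUm : g.measure U < ENNReal.ofReal δ := by
    refine (measure_union_le _ _).trans_lt ((ENNReal.add_lt_add hU₁m hU₂m).trans_eq ?_)
    rw [← ENNReal.ofReal_add (by positivity) (by positivity), add_halves]
  have hlocU : ∀ t ∈ E, (∀ᶠ x in 𝓝[<] t, Ico x t ⊆ U) ∧ ∀ᶠ y in 𝓝[>] t, Ico t y ⊆ U := by
    intro t ht
    have hn := hUo.mem_nhds (Or.inr (hU₂E ht))
    obtain ⟨l, u, htu, hlu⟩ := mem_nhds_iff_exists_Ioo_subset.1 hn
    constructor
    · filter_upwards [Ioo_mem_nhdsLT htu.1] with x hx v hv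
      exact hlu ⟨hx.1.trans_le hv.1, hv.2.trans htu.2⟩
    · filter_upwards [Ioo_mem_nhdsGT htu.2] with x hx v hv
      exact hlu ⟨htu.1.trans_le hv.1, hv.2.trans hx.2⟩
  have hgood : ∀ t ∈ Icc 0 T, t ∉ E → ∀ᶠ s in 𝓝[Icc 0 T ∩ {s | t ∈ g.D → t < s}] t,
      ‖f s - f t‖ ≤ ε₁ * |g s - g t| := by
    intro t ht htE
    have hC : t ∉ g.C := fun h => htE (Or.inr (Or.inr h))
    have hD : g.HasDerivAt 0 T f 0 t := by
      by_contra hn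
      refine htE (Or.inl ⟨⟨ht.1, lt_of_le_of_ne ht.2 ?_⟩, hn⟩)
      rintro rfl
      exact htE (Or.inr (Or.inl rfl))
    have h1 := ((hasDerivAt_iff hC).1 hD).norm.eventually_lt_const
      (show ‖(0 : 𝕜)‖ < ε₁ by rwa [norm_zero])
    rw [derivFilter, eventually_nhdsWithin_iff] at h1
    rw [eventually_nhdsWithin_iff]
    filter_upwards [h1] with s hs hs'
    -- The derivative says nothing where `g s = g t`, but absolute continuity forces `f s = f t`
    -- there.
    by_cases hg : g s = g t
    · rw [hf.eq_of_eq hs'.1 ht hg]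
      simpa using mul_nonneg hε₁0.le (abs_nonneg _)
    · have h2 := hs ⟨hs'.1, hs'.2, hg⟩
      rw [norm_div, RCLike.norm_ofReal, div_lt_iff₀ (abs_pos.2 (sub_ne_zero.2 hg))] at h2
      exact h2.le
  have hQ : g.GrowthBound f U ε₁ 0 c := by
    refine of_locally_of_additive hc.1 (growthBound_of_le (by simp))
      (fun x y z _ hxy hyz _ => GrowthBound.trans hUo.measurableSet hxy hyz) ?_ ?_
    · intro t ht
      have htT : t ∈ Icc 0 T := ⟨ht.1.le, ht.2.trans hc.2⟩
      by_cases htU : (∀ᶠ x in 𝓝[<] t, Ico x t ⊆ U)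
      · filter_upwards [htU, self_mem_nhdsWithin] with x hx hxt
        exact growthBound_of_subset hε₁0.le hxt hx
      · have htD : t ∉ g.D := fun hD =>
          htU ((hU₁D t hD).mono fun x hx => hx.trans subset_union_left)
        have h1 := hgood t htT fun h => htU (hlocU t h).1
        rw [eventually_nhdsWithin_iff] at h1
        filter_upwards [mem_nhdsWithin_of_mem_nhds h1, Ioo_mem_nhdsLT ht.1] with x hx hx0
        refine growthBound_of_le ?_
        have := hx ⟨⟨hx0.1.le, hx0.2.le.trans htT.2⟩, fun h => absurd h htD⟩
        rwa [norm_sub_rev, abs_sub_comm,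
          abs_of_nonneg (sub_nonneg.2 (g.monotone' hx0.2.le))] at this
    · intro t ht
      have htT : t ∈ Icc 0 T := ⟨ht.1, ht.2.le.trans hc.2⟩
      by_cases htU : (∀ᶠ y in 𝓝[>] t, Ico t y ⊆ U)
      · filter_upwards [htU, self_mem_nhdsWithin] with x hx hxt
        exact growthBound_of_subset hε₁0.le hxt hx
      · have h1 := hgood t htT fun h => htU (hlocU t h).2
        rw [eventually_nhdsWithin_iff] at h1
        filter_upwards [mem_nhdsWithin_of_mem_nhds h1, Ioo_mem_nhdsGT ht.2] with x hx hx0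
        refine growthBound_of_le ?_
        have := hx ⟨⟨ht.1.trans hx0.1.le, hx0.2.le.trans hc.2⟩, fun _ => hx0.1⟩
        rwa [abs_of_nonneg (sub_nonneg.2 (g.monotone' hx0.1.le))] at this
  obtain ⟨m, X, Y, hXY, hdisj, hsum, hle⟩ := hQ
  have h1 : g.measure.real (U ∩ Ico 0 c) < δ := by
    rw [measureReal_def]
    refine (ENNReal.toReal_lt_of_lt_ofReal ?_)
    exact (measure_mono inter_subset_left).trans_lt hUm
  have h2 := hac m X Y (fun i => ⟨(hXY i).1, (hXY i).2.1, (hXY i).2.2.trans hc.2⟩) hdisj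
    (hsum.trans_lt h1)
  have h3 : ε₁ * (g c - g 0) ≤ ε / 2 := by
    rw [hε₁, div_mul_eq_mul_div, div_le_iff₀ (by positivity)]
    exact mul_le_mul_of_nonneg_left (by linarith) (by positivity)
  linarith

/-! ### Boundedness, products and inverses -/

theorem AbsCont.exists_bound {g : Derivator} {a b : ℝ} {f : ℝ → 𝕜} (hf : g.AbsCont a b f) :
    ∃ M : ℝ, ∀ t ∈ Icc a b, ‖f t‖ ≤ M := by
  rcases le_or_gt a b with hab | hab
  swap
  · exact ⟨0, fun t ht => absurd (ht.1.trans ht.2) (not_le.2 hab)⟩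
  obtain ⟨δ, hδ, h⟩ := hf.exists_norm_sub_lt one_pos
  refine of_locally_of_additive hab (Q := fun x y => x ≤ y → y ≤ b → a ≤ x →
    ∃ M : ℝ, ∀ t ∈ Icc x y, ‖f t‖ ≤ M) ?_ ?_ ?_ ?_ hab le_rfl le_rfl
  · exact fun _ _ _ => ⟨‖f a‖, fun t ht => by rw [le_antisymm ht.2 ht.1]⟩
  · intro x y z hx hxy hyz hz h1 h2 _ _ _
    obtain ⟨M, hM⟩ := h1 hxy (hyz.trans hz) hx
    obtain ⟨M', hM'⟩ := h2 hyz hz (hx.trans hxy)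
    refine ⟨max M M', fun t ht => ?_⟩
    rcases le_total t y with hty | hty
    · exact (hM t ⟨ht.1, hty⟩).trans (le_max_left _ _)
    · exact (hM' t ⟨hty, ht.2⟩).trans (le_max_right _ _)
  · intro t ht
    have h2 : Tendsto g.toFun (𝓝[<] t) (𝓝 (g t)) :=
      (g.leftCont' t).mono_left (nhdsWithin_mono _ Iio_subset_Iic_self)
    filter_upwards [h2.eventually_const_lt (show g t - δ < g t by linarith)] with x hx hxt htb hax
    refine ⟨‖f t‖ + 1, fun s hs => ?_⟩
    have h3 := h s t (hax.trans hs.1) hs.2 htb (by linarith [g.monotone' hs.1])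
    have h4 : ‖f s‖ ≤ ‖f t‖ + ‖f t - f s‖ := norm_le_norm_add_norm_sub _ _
    linarith
  · intro t ht
    have h2 := (g.tendsto_nhdsGT t).eventually_lt_const
      (show g.jump t < g.jump t + δ by linarith)
    filter_upwards [h2, self_mem_nhdsWithin] with x hx hxt' htx hxb hax
    -- Points of `(t, x]` are compared with `x` and not with `t`: `f` may jump at `t`, whereas past
    -- `t` the jump of `g` has been left behind and the remaining growth is below `δ`.
    refine ⟨max ‖f t‖ (‖f x‖ + 1), fun s hs => ?_⟩
    rcases hs.1.eq_or_lt with rfl | hts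
    · exact le_max_left _ _
    · have h3 := h s x (hax.trans hs.1) hs.2 hxb (by linarith [g.jump_le hts])
      have h4 : ‖f s‖ ≤ ‖f x‖ + ‖f x - f s‖ := norm_le_norm_add_norm_sub _ _
      exact (by linarith : ‖f s‖ ≤ ‖f x‖ + 1).trans (le_max_right _ _)

theorem AbsCont.mul {g : Derivator} {a b : ℝ} {f h : ℝ → 𝕜} (hf : g.AbsCont a b f)
    (hh : g.AbsCont a b h) : g.AbsCont a b (fun t => f t * h t) := by
  obtain ⟨M, hM⟩ := hf.exists_bound
  obtain ⟨M', hM'⟩ := hh.exists_bound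
  intro ε hε
  obtain ⟨δ, hδ, hd⟩ := hf (ε / 2 / (|M'| + 1)) (by positivity)
  obtain ⟨δ', hδ', hd'⟩ := hh (ε / 2 / (|M| + 1)) (by positivity)
  refine ⟨min δ δ', lt_min hδ hδ', fun m x y hxy hdisj hsum => ?_⟩
  have h1 := hd m x y hxy hdisj (hsum.trans_le (min_le_left _ _))
  have h2 := hd' m x y hxy hdisj (hsum.trans_le (min_le_right _ _))
  rw [lt_div_iff₀ (by positivity), Finset.sum_mul] at h1 h2
  have h3 : ∑ i, ‖f (y i) * h (y i) - f (x i) * h (x i)‖ ≤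
      ∑ i, (‖f (y i) - f (x i)‖ * (|M'| + 1) + ‖h (y i) - h (x i)‖ * (|M| + 1)) := by
    refine Finset.sum_le_sum fun i _ => ?_
    obtain ⟨i1, i2, i3⟩ := hxy i
    have e : f (y i) * h (y i) - f (x i) * h (x i) =
      (f (y i) - f (x i)) * h (y i) + (h (y i) - h (x i)) * f (x i) := by ring
    rw [e]
    refine (norm_add_le _ _).trans ?_
    rw [norm_mul, norm_mul]
    have b1 := hM' (y i) ⟨i1.trans i2.le, i3⟩
    have b2 := hM (x i) ⟨i1, i2.le.trans i3⟩
    gcongr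
    · linarith [le_abs_self M']
    · linarith [le_abs_self M]
  rw [Finset.sum_add_distrib] at h3
  linarith

theorem LipschitzWrt.inv {g : Derivator} {a b K c : ℝ} {f : ℝ → 𝕜} (hf : g.LipschitzWrt a b K f)
    (hc : 0 < c) (hfc : ∀ t ∈ Icc a b, c ≤ ‖f t‖) :
    g.LipschitzWrt a b (K / (c * c)) (fun t => (f t)⁻¹) := by
  intro x hx y hy hxy
  have hx0 : f x ≠ 0 := norm_pos_iff.1 (hc.trans_le (hfc x hx))
  have hy0 : f y ≠ 0 := norm_pos_iff.1 (hc.trans_le (hfc y hy))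
  rw [inv_sub_inv hy0 hx0, norm_div, norm_mul, norm_sub_rev, div_mul_eq_mul_div]
  have h1 := hf x hx y hy hxy
  exact div_le_div₀ ((norm_nonneg _).trans h1) h1 (by positivity)
    (mul_le_mul (hfc y hy) (hfc x hx) hc.le (norm_nonneg _))

/-! ### Integration with respect to `μ_g` and primitives -/

/-- Off the exceptional sets `f` is continuous in the ordinary sense, because `g` is. `C_g ∪ N_g` is
null, and the countable set `D_g` may carry arbitrary values, which is the freedom that
`expIntegrand` needs. -/
theorem MemBD.aestronglyMeasurable_of_eqOn {g : Derivator} {a b : ℝ} {f φ : ℝ → 𝕜}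
    (hf : g.MemBD a b f) (h : EqOn φ f (Icc a b \ (g.C ∪ g.N ∪ g.D))) :
    AEStronglyMeasurable φ (g.measure.restrict (Ico a b)) := by
  classical
  set A := Icc a b \ (g.C ∪ g.N ∪ g.D) with hA
  have hAm : MeasurableSet A := measurableSet_Icc.diff
    ((g.isOpen_C.measurableSet.union g.countable_N.measurableSet).union g.countable_D.measurableSet)
  have hcont : ContinuousOn f A := by
    intro t ht
    rw [ContinuousWithinAt, Metric.tendsto_nhds]
    intro ε hε
    obtain ⟨δ, hδ, hd⟩ := hf.2.1 t ht ε hε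
    have hD : t ∉ g.D := fun h => ht.2 (Or.inr h)
    have h1 := Metric.tendsto_nhds.1 (continuousAt_of_notMem_D hD).tendsto δ hδ
    filter_upwards [mem_nhdsWithin_of_mem_nhds h1, self_mem_nhdsWithin] with s hs hsA
    rw [dist_comm, dist_eq_norm]
    exact hd s hsA.1 (by rwa [dist_comm, Real.dist_eq] at hs)
  have hmeas : Measurable (A.piecewise f fun _ => 0) :=
    hcont.measurable_piecewise continuousOn_const hAm
  have hmeas' : Measurable (g.D.piecewise φ (A.piecewise f fun _ => 0)) := by
    refine hmeas.measurable_of_countable_ne (g.countable_D.mono fun t ht => ?_)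
    by_contra hD
    exact ht (piecewise_eq_of_notMem g.D φ _ hD).symm
  refine ⟨_, hmeas'.stronglyMeasurable, ?_⟩
  have hnull : ∀ᵐ t ∂g.measure, t ∉ g.C ∪ g.N :=
    measure_eq_zero_iff_ae_notMem.1 (measure_union_null g.measure_C g.measure_N)
  filter_upwards [ae_restrict_of_ae hnull, ae_restrict_mem measurableSet_Ico] with t ht htI
  by_cases hD : t ∈ g.D
  · rw [piecewise_eq_of_mem _ _ _ hD]
  · have htA : t ∈ A := ⟨Ico_subset_Icc_self htI, fun h => h.elim ht hD⟩
    rw [piecewise_eq_of_notMem _ _ _ hD, piecewise_eq_of_mem _ _ _ htA, h htA]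

theorem measure_Ico_lt_top (g : Derivator) (x y : ℝ) : g.measure (Ico x y) < ⊤ := by
  rw [measure_Ico]
  exact ENNReal.ofReal_lt_top

theorem integrableOn_of_bound {g : Derivator} {a b M : ℝ} {φ : ℝ → 𝕜}
    (hφ : AEStronglyMeasurable φ (g.measure.restrict (Ico a b)))
    (hM : ∀ t ∈ Icc a b, ‖φ t‖ ≤ M) : IntegrableOn φ (Ico a b) g.measure :=
  IntegrableOn.of_bound (g.measure_Ico_lt_top a b) hφ M
    ((ae_restrict_mem measurableSet_Ico).mono fun t ht => hM t (Ico_subset_Icc_self ht))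

theorem MemBD.integrableOn {g : Derivator} {a b : ℝ} {f : ℝ → 𝕜} (hf : g.MemBD a b f) :
    IntegrableOn f (Ico a b) g.measure := by
  obtain ⟨M, hM⟩ := hf.1
  exact integrableOn_of_bound (hf.aestronglyMeasurable_of_eqOn fun _ _ => rfl) hM

/-- `f` is a primitive of `φ` with respect to `μ_g` on `[a, b]`. -/
def IsPrimitive (g : Derivator) (a b : ℝ) (f φ : ℝ → 𝕜) : Prop :=
  ∀ x ∈ Icc a b, ∀ y ∈ Icc a b, x ≤ y → f y - f x = ∫ s in Ico x y, φ s ∂g.measure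

theorem isPrimitive_integral {g : Derivator} {a b : ℝ} {φ : ℝ → 𝕜}
    (hφ : IntegrableOn φ (Ico a b) g.measure) :
    g.IsPrimitive a b (fun t => ∫ s in Ico a t, φ s ∂g.measure) φ := by
  intro x hx y hy hxy
  have h1 : Ico a y = Ico a x ∪ Ico x y := (Ico_union_Ico_eq_Ico hx.1 hxy).symm
  beta_reduce
  rw [h1, setIntegral_union _ measurableSet_Ico
    (hφ.mono_set (Ico_subset_Ico_right hx.2)) (hφ.mono_set (Ico_subset_Ico hx.1 hy.2)),
    add_sub_cancel_left]
  exact disjoint_left.2 fun u hu hu' => by linarith [hu.2, hu'.1]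

theorem IsPrimitive.lipschitzWrt {g : Derivator} {a b M : ℝ} {f φ : ℝ → 𝕜}
    (hf : g.IsPrimitive a b f φ) (hM : ∀ t ∈ Icc a b, ‖φ t‖ ≤ M) : g.LipschitzWrt a b M f := by
  intro x hx y hy hxy
  rw [hf x hx y hy hxy, ← g.measureReal_Ico hxy]
  exact norm_setIntegral_le_of_norm_le_const (g.measure_Ico_lt_top x y)
    fun t ht => hM t ⟨hx.1.trans ht.1, ht.2.le.trans hy.2⟩

theorem IsPrimitive.sub_sub_eq {g : Derivator} {a b : ℝ} {f φ : ℝ → 𝕜}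
    (hf : g.IsPrimitive a b f φ) (hφ : IntegrableOn φ (Ico a b) g.measure) {x y : ℝ} (hx : a ≤ x)
    (hxy : x ≤ y) (hy : y ≤ b) (c : 𝕜) :
    f y - f x - ((g y - g x : ℝ) : 𝕜) * c = ∫ s in Ico x y, (φ s - c) ∂g.measure := by
  rw [integral_sub (hφ.mono_set (Ico_subset_Ico hx hy))
    (integrableOn_const (g.measure_Ico_lt_top x y).ne), setIntegral_const,
    g.measureReal_Ico hxy, RCLike.real_smul_eq_coe_mul,
    hf x ⟨hx, hxy.trans hy⟩ y ⟨hx.trans hxy, hy⟩ hxy]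

theorem IsPrimitive.norm_sub_sub_le {g : Derivator} {a b : ℝ} {f φ : ℝ → 𝕜}
    (hf : g.IsPrimitive a b f φ) (hφ : IntegrableOn φ (Ico a b) g.measure) {x y ε : ℝ} (hx : a ≤ x)
    (hxy : x ≤ y) (hy : y ≤ b) {c : 𝕜} (h : ∀ u ∈ Ico x y, ‖φ u - c‖ ≤ ε) :
    ‖f y - f x - ((g y - g x : ℝ) : 𝕜) * c‖ ≤ ε * (g y - g x) := by
  rw [hf.sub_sub_eq hφ hx hxy hy, ← g.measureReal_Ico hxy]
  exact norm_setIntegral_le_of_norm_le_const (g.measure_Ico_lt_top x y) h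

theorem measureReal_Ioo (g : Derivator) {x y : ℝ} (h : x < y) :
    g.measure.real (Ioo x y) = g y - g x - g.jump x := by
  have h1 : insert x (Ioo x y) = Ico x y := Ioo_insert_left h
  have h2 : g.measure.real (Ico x y) = g.measure.real {x} + g.measure.real (Ioo x y) := by
    rw [← h1, insert_eq]
    refine measureReal_union (by simp) measurableSet_Ioo ?_ ?_
    · rw [measure_singleton]; exact ENNReal.ofReal_ne_top
    · exact ((measure_mono Ioo_subset_Ico_self).trans_lt (g.measure_Ico_lt_top x y)).ne
  rw [g.measureReal_Ico h.le, measureReal_def, measure_singleton,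
    ENNReal.toReal_ofReal (g.jump_nonneg x)] at h2
  linarith

/-- At a jump the atom at `t` dominates: `(t, s)` has measure tending to zero while `g s - g t`
tends to `Δg(t) > 0`, so boundedness of `φ` suffices. Elsewhere `φ` is nearly constant between `t`
and `s`. -/
theorem IsPrimitive.hasDerivAt {g : Derivator} {a b M t : ℝ} {f φ : ℝ → 𝕜}
    (hf : g.IsPrimitive a b f φ) (hφ : IntegrableOn φ (Ico a b) g.measure)
    (hM : ∀ t ∈ Icc a b, ‖φ t‖ ≤ M) (ht : t ∈ Icc a b) (hC : t ∉ g.C)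
    (hc : t ∉ g.D → g.ContBetween a b φ t) : g.HasDerivAt a b f (φ t) t := by
  rw [hasDerivAt_iff hC]
  have hq : ∀ s, ((g s - g t : ℝ) : 𝕜) ≠ 0 → (f s - f t) / ((g s - g t : ℝ) : 𝕜) - φ t =
      (f s - f t - ((g s - g t : ℝ) : 𝕜) * φ t) / ((g s - g t : ℝ) : 𝕜) := by
    intro s hs
    rw [sub_div (f s - f t), mul_div_cancel_left₀ _ hs]
  by_cases hD : t ∈ g.D
  · rw [tendsto_iff_norm_sub_tendsto_zero]
    have h1 := g.tendsto_derivFilter a b t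
    have h2 : Tendsto (fun s => 2 * M * (g s - g t - g.jump t) / (g s - g t))
        (g.derivFilter a b t) (𝓝 (2 * M * (g.jump t - g.jump t) / g.jump t)) :=
      ((h1.sub_const _).const_mul _).div h1 (ne_of_gt hD)
    rw [sub_self, mul_zero, zero_div] at h2
    refine squeeze_zero' (Eventually.of_forall fun _ => norm_nonneg _) ?_ h2
    filter_upwards [g.eventually_derivFilter_ne (𝕜 := 𝕜) a b t,
      g.eventually_derivFilter_mem a b t] with s hs hs'
    have hts := hs'.2.1 hD
    have hg : 0 < g s - g t := hD.trans_le (g.jump_le hts)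
    rw [hq s hs, norm_div, RCLike.norm_ofReal, abs_of_pos hg]
    refine div_le_div_of_nonneg_right ?_ hg.le
    rw [hf.sub_sub_eq hφ ht.1 hts.le hs'.1.2, ← g.measureReal_Ioo hts,
      setIntegral_eq_of_subset_of_forall_sdiff_eq_zero measurableSet_Ico Ioo_subset_Ico_self]
    · refine norm_setIntegral_le_of_norm_le_const
        ((measure_mono Ioo_subset_Ico_self).trans_lt (g.measure_Ico_lt_top t s)) fun u hu => ?_
      have h3 := hM u ⟨ht.1.trans hu.1.le, hu.2.le.trans hs'.1.2⟩
      have h4 := hM t ht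
      linarith [norm_sub_le (φ u) (φ t)]
    · intro u hu
      have : u = t := by
        rcases hu.1.1.eq_or_lt with h | h
        · exact h.symm
        · exact absurd ⟨h, hu.1.2⟩ hu.2
      rw [this, sub_self]
  · rw [Metric.tendsto_nhds]
    intro ε hε
    filter_upwards [hc hD (ε / 2) (half_pos hε), g.eventually_derivFilter_ne (𝕜 := 𝕜) a b t,
      g.eventually_derivFilter_mem a b t] with s h1 hs hs'
    rw [dist_eq_norm, hq s hs, norm_div, RCLike.norm_ofReal]
    refine lt_of_le_of_lt ?_ (half_lt_self hε)
    have hg : g s ≠ g t := hs'.2.2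
    rw [div_le_iff₀ (abs_pos.2 (sub_ne_zero.2 hg))]
    rcases le_total t s with h | h
    · rw [min_eq_right h, max_eq_left h] at h1
      rw [abs_of_nonneg (sub_nonneg.2 (g.monotone' h))]
      exact hf.norm_sub_sub_le hφ ht.1 h hs'.1.2 fun u hu =>
        h1 u ⟨ht.1.trans hu.1, hu.2.le.trans hs'.1.2⟩ hu
    · rw [min_eq_left h, max_eq_right h] at h1
      rw [abs_sub_comm, abs_of_nonneg (sub_nonneg.2 (g.monotone' h)), ← norm_neg]
      refine le_of_eq_of_le ?_ (hf.norm_sub_sub_le hφ hs'.1.1 h ht.2 fun u hu =>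
        h1 u ⟨hs'.1.1.trans hu.1, hu.2.le.trans ht.2⟩ hu)
      congr 1
      push_cast
      ring

/-- A point of `D_g` has positive mass. At any other point, the interval between `t` and a nearby
`s` with `g s ≠ g t` has positive measure, so it contains a zero of `f`, and `f` is almost constant
there. -/
theorem MemBD.eq_zero_of_ae {g : Derivator} {T t : ℝ} (hTD : T ∉ g.D) {f : ℝ → 𝕜}
    (hf : g.MemBD 0 T f) (hae : ∀ᵐ s ∂(g.measure.restrict (Ico 0 T)), f s = 0)
    (ht : t ∈ Icc 0 T) (hC : t ∉ g.C) (hF : NeBot (g.derivFilter 0 T t)) : f t = 0 := by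
  have key : ∀ A ⊆ Ico 0 T, g.measure A ≠ 0 → ∃ u ∈ A, f u = 0 := by
    intro A hA hA0
    by_contra! hne
    rw [ae_restrict_iff' measurableSet_Ico, ae_iff] at hae
    refine hA0 (measure_mono_null (fun u hu => ?_) hae)
    exact fun h => hne u hu (h (hA hu))
  by_cases hD : t ∈ g.D
  · have htT : t < T := lt_of_le_of_ne ht.2 (by rintro rfl; exact hTD hD)
    obtain ⟨u, hu, hu0⟩ := key {t} (singleton_subset_iff.2 ⟨ht.1, htT⟩)
      (by rw [measure_singleton]; exact (ENNReal.ofReal_pos.2 hD).ne')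
    rwa [mem_singleton_iff.1 hu] at hu0
  · refine norm_le_zero_iff.1 (le_of_forall_pos_le_add fun ε hε => ?_)
    obtain ⟨s, h1, hs⟩ := ((hf.contBetween ht hC hD ε hε).and
      (g.eventually_derivFilter_mem 0 T t)).exists
    have hsub : Ico (min s t) (max s t) ⊆ Ico 0 T :=
      Ico_subset_Ico (le_min hs.1.1 ht.1) (max_le hs.1.2 ht.2)
    obtain ⟨u, hu, hu0⟩ := key _ hsub (by
      rw [measure_Ico]
      refine (ENNReal.ofReal_pos.2 (sub_pos.2 ?_)).ne'
      rcases le_total s t with h | h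
      · rw [min_eq_left h, max_eq_right h]
        exact lt_of_le_of_ne (g.monotone' h) hs.2.2
      · rw [min_eq_right h, max_eq_left h]
        exact lt_of_le_of_ne (g.monotone' h) hs.2.2.symm)
    have h2 := h1 u (Ico_subset_Icc_self (hsub hu)) hu
    rw [hu0, zero_sub, norm_neg] at h2
    linarith

/-! ### The `g`-exponential -/

theorem finite_le_jump (g : Derivator) (a b : ℝ) {c : ℝ} (hc : 0 < c) :
    {t | t ∈ Icc a b ∧ c ≤ g.jump t}.Finite := by
  have h1 := Measure.finite_const_le_meas_of_disjoint_iUnion g.measure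
    (ENNReal.ofReal_pos.2 hc) (As := fun t => {t} ∩ Ico a (b + 1))
    (fun t => (measurableSet_singleton t).inter measurableSet_Ico)
    (fun s t hst => disjoint_left.2 fun u hu hu' => hst (hu.1.symm.trans hu'.1))
    (ne_top_of_le_ne_top (g.measure_Ico_lt_top a (b + 1)).ne
      (measure_mono (iUnion_subset fun t => inter_subset_right)))
  refine h1.subset fun t ht => ?_
  have h2 : {t} ∩ Ico a (b + 1) = {t} :=
    inter_eq_left.2 (singleton_subset_iff.2 ⟨ht.1.1, by linarith [ht.1.2]⟩)
  show _ ≤ g.measure ({t} ∩ Ico a (b + 1))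
  rw [h2, measure_singleton]
  exact ENNReal.ofReal_le_ofReal ht.2

theorem expIntegrand_of_notMem {g : Derivator} {t : ℝ} (h : t ∉ g.D) (p : ℝ → ℂ) :
    g.expIntegrand p t = p t := if_neg h

theorem expIntegrand_of_mem {g : Derivator} {t : ℝ} (h : t ∈ g.D) (p : ℝ → ℂ) :
    g.expIntegrand p t = Complex.log (1 + p t * (g.jump t : ℂ)) / (g.jump t : ℂ) := if_pos h

theorem norm_jump (g : Derivator) (t : ℝ) : ‖(g.jump t : ℂ)‖ = g.jump t := by
  rw [Complex.norm_real, Real.norm_of_nonneg (g.jump_nonneg t)]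

/-- Only finitely many jumps have size at least `1 / (2M)`. At the others `z = p Δg` satisfies `|z|
≤ 1/2`, so `|log (1 + z)| ≤ 3/2 |z|`. -/
theorem MemBD.exists_bound_expIntegrand {g : Derivator} {a b : ℝ} {p : ℝ → ℂ}
    (hp : g.MemBD a b p) : ∃ M : ℝ, 0 ≤ M ∧ ∀ t ∈ Icc a b, ‖g.expIntegrand p t‖ ≤ M := by
  obtain ⟨M₀, hM₀⟩ := hp.1
  set M := max M₀ 1
  have hM1 : 1 ≤ M := le_max_right _ _
  have hM : ∀ t ∈ Icc a b, ‖p t‖ ≤ M := fun t ht => (hM₀ t ht).trans (le_max_left _ _)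
  obtain ⟨K, hK⟩ := ((g.finite_le_jump a b (c := 1 / (2 * M)) (by positivity)).image
    fun t => ‖g.expIntegrand p t‖).bddAbove
  refine ⟨max K (2 * M), le_max_of_le_right (by positivity), fun t ht => ?_⟩
  by_cases hj : 1 / (2 * M) ≤ g.jump t
  · exact (hK ⟨t, ⟨ht, hj⟩, rfl⟩).trans (le_max_left _ _)
  · refine le_trans ?_ (le_max_right _ _)
    by_cases hD : t ∈ g.D
    · have hj0 : 0 < g.jump t := hD
      rw [not_le, lt_div_iff₀ (by positivity)] at hj
      have h1 : ‖p t * (g.jump t : ℂ)‖ ≤ M * g.jump t := by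
        rw [norm_mul, norm_jump]
        exact mul_le_mul_of_nonneg_right (hM t ht) hj0.le
      rw [expIntegrand_of_mem hD, norm_div, norm_jump, div_le_iff₀ hj0]
      have h2 := Complex.norm_log_one_add_half_le_self (z := p t * (g.jump t : ℂ)) (by linarith)
      nlinarith
    · rw [expIntegrand_of_notMem hD]
      linarith [hM t ht]

/-- Any jump between `t` and `s` is at most `|g s - g t|`, and `|log (1 + z) - z| ≤ |z|²` for `|z| ≤
1/2`. Replacing `p` by the logarithmic quotient thus changes it by at most `M² Δg`, which is small
near `t`. -/
theorem MemBD.contBetween_expIntegrand {g : Derivator} {a b t : ℝ} {p : ℝ → ℂ}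
    (hp : g.MemBD a b p) (ht : t ∈ Icc a b) (hC : t ∉ g.C) (hD : t ∉ g.D) :
    g.ContBetween a b (g.expIntegrand p) t := by
  intro ε hε
  obtain ⟨M₀, hM₀⟩ := hp.1
  set M := max M₀ 1
  have hM1 : 1 ≤ M := le_max_right _ _
  have hM : ∀ t ∈ Icc a b, ‖p t‖ ≤ M := fun t ht => (hM₀ t ht).trans (le_max_left _ _)
  filter_upwards [hp.contBetween ht hC hD (ε / 2) (half_pos hε),
    eventually_derivFilter_abs_sub_lt hD (show 0 < 1 / (2 * M) by positivity),
    eventually_derivFilter_abs_sub_lt hD (show 0 < ε / 2 / (M * M) by positivity)]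
    with s h1 h2 h3 u hu hus
  rw [expIntegrand_of_notMem hD]
  have h4 := h1 u hu hus
  by_cases huD : u ∈ g.D
  · have hj0 : 0 < g.jump u := huD
    have hjs : g.jump u ≤ |g s - g t| := by
      have hj := g.jump_le hus.2
      rcases le_total s t with h | h
      · rw [max_eq_right h] at hj
        rw [min_eq_left h] at hus
        rw [abs_sub_comm]
        exact (hj.trans (by linarith [g.monotone' hus.1])).trans (le_abs_self _)
      · rw [max_eq_left h] at hj
        rw [min_eq_right h] at hus
        exact (hj.trans (by linarith [g.monotone' hus.1])).trans (le_abs_self _)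
    have hz : ‖p u * (g.jump u : ℂ)‖ ≤ M * g.jump u := by
      rw [norm_mul, norm_jump]
      exact mul_le_mul_of_nonneg_right (hM u hu) hj0.le
    have hj1 := hjs.trans_lt h2
    have hj2 := hjs.trans_lt h3
    rw [lt_div_iff₀ (by positivity)] at hj1 hj2
    have hz2 : ‖p u * (g.jump u : ℂ)‖ ≤ 1 / 2 := by linarith
    have h5 := Complex.norm_log_one_add_sub_self_le (z := p u * (g.jump u : ℂ)) (by linarith)
    have h6 : (1 - ‖p u * (g.jump u : ℂ)‖)⁻¹ ≤ 2 := by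
      rw [inv_le_comm₀ (by linarith) (by norm_num)]
      linarith
    have h7 : ‖Complex.log (1 + p u * (g.jump u : ℂ)) - p u * (g.jump u : ℂ)‖ ≤
        (M * g.jump u) ^ 2 := by
      refine h5.trans ?_
      have h8 : ‖p u * (g.jump u : ℂ)‖ ^ 2 ≤ (M * g.jump u) ^ 2 :=
        pow_le_pow_left₀ (norm_nonneg _) hz 2
      have h9 : 0 ≤ ‖p u * (g.jump u : ℂ)‖ ^ 2 := by positivity
      nlinarith
    have hne : (g.jump u : ℂ) ≠ 0 := Complex.ofReal_ne_zero.2 hj0.ne'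
    have h10 : ‖g.expIntegrand p u - p u‖ ≤ ε / 2 := by
      have e : g.expIntegrand p u - p u =
          (Complex.log (1 + p u * (g.jump u : ℂ)) - p u * (g.jump u : ℂ)) / (g.jump u : ℂ) := by
        rw [expIntegrand_of_mem huD, sub_div, mul_div_cancel_right₀ _ hne]
      rw [e, norm_div, norm_jump, div_le_iff₀ hj0]
      refine h7.trans ?_
      nlinarith
    have e : g.expIntegrand p u - p t = (g.expIntegrand p u - p u) + (p u - p t) := by ring
    rw [e]
    exact (norm_add_le _ _).trans (by linarith)
  · rw [expIntegrand_of_notMem huD]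
    linarith

theorem MemBD.integrableOn_expIntegrand {g : Derivator} {a b : ℝ} {p : ℝ → ℂ}
    (hp : g.MemBD a b p) : IntegrableOn (g.expIntegrand p) (Ico a b) g.measure := by
  obtain ⟨M, _, hM⟩ := hp.exists_bound_expIntegrand
  exact integrableOn_of_bound (hp.aestronglyMeasurable_of_eqOn fun t ht =>
    expIntegrand_of_notMem (fun hD => ht.2 (Or.inr hD)) p) hM

theorem gExp_zero (g : Derivator) (p : ℝ → ℂ) : g.gExp p 0 = 1 := by simp [gExp]

/-- At a jump the exponential undoes the logarithm, so the choice of branch is immaterial. Elsewhere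
`dslope` expresses the chain rule without dividing by `B s - B t`, which may vanish. -/
theorem hasDerivAt_gExp {g : Derivator} {T t : ℝ} {p : ℝ → ℂ} (hp : g.MemBD 0 T p)
    (hreg : g.Regressive 0 T p) (ht : t ∈ Icc 0 T) (hC : t ∉ g.C) :
    g.HasDerivAt 0 T (g.gExp p) (p t * g.gExp p t) t := by
  obtain ⟨M, _, hM⟩ := hp.exists_bound_expIntegrand
  set B : ℝ → ℂ := fun t => ∫ s in Ico 0 t, g.expIntegrand p s ∂g.measure with hB
  have hBd : g.HasDerivAt 0 T B (g.expIntegrand p t) t :=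
    (isPrimitive_integral hp.integrableOn_expIntegrand).hasDerivAt hp.integrableOn_expIntegrand
      hM ht hC fun hD => hp.contBetween_expIntegrand ht hC hD
  have hBt := hBd.tendsto hC
  rw [hasDerivAt_iff hC] at hBd ⊢
  have hV : ∀ s, g.gExp p s = Complex.exp (B s) := fun _ => rfl
  by_cases hD : t ∈ g.D
  · have hj : (g.jump t : ℂ) ≠ 0 := Complex.ofReal_ne_zero.2 (ne_of_gt hD)
    have h1 : Complex.exp (B t + g.expIntegrand p t * ((g.jump t : ℝ) : ℂ)) =
        g.gExp p t * (1 + p t * (g.jump t : ℂ)) := by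
      have h0 : 1 + p t * (g.jump t : ℂ) ≠ 0 := hreg t ⟨ht, hD⟩
      rw [expIntegrand_of_mem hD, div_mul_cancel₀ _ hj, Complex.exp_add, Complex.exp_log h0]
      rfl
    have h2 : Tendsto (g.gExp p) (g.derivFilter 0 T t)
        (𝓝 (g.gExp p t * (1 + p t * (g.jump t : ℂ)))) := by
      rw [← h1]
      exact (Complex.continuous_exp.tendsto _).comp hBt
    have h3 := (h2.sub_const (g.gExp p t)).div
      ((Complex.continuous_ofReal.tendsto _).comp (g.tendsto_derivFilter 0 T t)) hj
    have h4 : (g.gExp p t * (1 + p t * (g.jump t : ℂ)) - g.gExp p t) / (g.jump t : ℂ) =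
        p t * g.gExp p t := by
      field_simp
      ring
    rw [h4] at h3
    exact h3
  · rw [jump_eq_zero hD] at hBt
    rw [expIntegrand_of_notMem hD] at hBd hBt
    have h1 : Tendsto (fun s => dslope Complex.exp (B t) (B s)) (g.derivFilter 0 T t)
        (𝓝 (Complex.exp (B t))) := by
      have h2 : ContinuousAt (dslope Complex.exp (B t)) (B t) :=
        continuousAt_dslope_same.2 Complex.differentiableAt_exp
      have h3 : dslope Complex.exp (B t) (B t) = Complex.exp (B t) := by
        rw [dslope_same, Complex.deriv_exp]
      rw [← h3]
      refine h2.tendsto.comp ?_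
      simpa using hBt
    refine (hBd.mul h1).congr fun s => ?_
    rw [hV, hV, ← sub_smul_dslope Complex.exp (B t) (B s), smul_eq_mul, div_mul_eq_mul_div]

/-- The exponent stays in a ball of radius `R`, on which `exp` is Lipschitz with constant `exp R`
and at least `exp (-R)` in modulus. -/
theorem gExp_bounds {g : Derivator} {T : ℝ} {p : ℝ → ℂ} (hp : g.MemBD 0 T p) :
    (∃ c > 0, ∀ t ∈ Icc 0 T, c ≤ ‖g.gExp p t‖) ∧ ∃ K, g.LipschitzWrt 0 T K (g.gExp p) := by
  obtain ⟨M, hM0, hM⟩ := hp.exists_bound_expIntegrand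
  set B : ℝ → ℂ := fun t => ∫ s in Ico 0 t, g.expIntegrand p s ∂g.measure with hB
  have hBL : g.LipschitzWrt 0 T M B :=
    (isPrimitive_integral hp.integrableOn_expIntegrand).lipschitzWrt hM
  obtain ⟨R, hR⟩ := hBL.memBD.1
  have hV : ∀ s, g.gExp p s = Complex.exp (B s) := fun _ => rfl
  refine ⟨⟨Real.exp (-R), Real.exp_pos _, fun t ht => ?_⟩, Real.exp R * M,
    fun x hx y hy hxy => ?_⟩
  · rw [hV, Complex.norm_exp, Real.exp_le_exp]
    have h1 := (Complex.abs_re_le_norm (B t)).trans (hR t ht)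
    exact neg_le_of_abs_le h1
  · have h1 : ‖Complex.exp (B y) - Complex.exp (B x)‖ ≤ Real.exp R * ‖B y - B x‖ := by
      refine (convex_closedBall (0 : ℂ) R).norm_image_sub_le_of_norm_deriv_le
        (fun z _ => Complex.differentiableAt_exp) (fun z hz => ?_) (by simpa using hR x hx)
        (by simpa using hR y hy)
      rw [Complex.deriv_exp, Complex.norm_exp, Real.exp_le_exp]
      exact (Complex.re_le_norm z).trans (by simpa using hz)
    rw [hV, hV, mul_assoc]
    exact h1.trans (mul_le_mul_of_nonneg_left (hBL x hx y hy hxy) (Real.exp_pos _).le)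

/-! ### Uniqueness, and solutions over `ℝ` and `ℂ` -/

theorem ae_notMem_C (g : Derivator) (s : Set ℝ) : ∀ᵐ t ∂(g.measure.restrict s), t ∉ g.C :=
  ae_restrict_of_ae (measure_eq_zero_iff_ae_notMem.1 g.measure_C)

theorem ae_of_forall {g : Derivator} {a b : ℝ} {P : ℝ → Prop}
    (h : ∀ t ∈ Icc a b, t ∉ g.C → P t) : ∀ᵐ t ∂(g.measure.restrict (Ico a b)), P t := by
  filter_upwards [g.ae_notMem_C (Ico a b), ae_restrict_mem measurableSet_Ico] with t ht htI
  exact h t (Ico_subset_Icc_self htI) ht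

theorem AbsCont.eqOn_of_hasDerivAt {g : Derivator} {T c K : ℝ} (hTD : T ∉ g.D)
    {β u v : ℝ → 𝕜} (hreg : g.Regressive 0 T β) (hu : g.AbsCont 0 T u)
    (hv : g.LipschitzWrt 0 T K v) (hc : 0 < c) (hvc : ∀ t ∈ Icc 0 T, c ≤ ‖v t‖)
    (hud : ∀ᵐ t ∂(g.measure.restrict (Ico 0 T)), g.HasDerivAt 0 T u (β t * u t) t)
    (hvd : ∀ᵐ t ∂(g.measure.restrict (Ico 0 T)), g.HasDerivAt 0 T v (β t * v t) t)
    (h0 : u 0 = v 0) : EqOn u v (Icc 0 T) := by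
  have hne : ∀ t ∈ Icc 0 T, v t ≠ 0 := fun t ht => norm_pos_iff.1 (hc.trans_le (hvc t ht))
  intro t ht
  have h1 := (hu.mul (hv.inv hc hvc).absCont).eq_of_hasDerivAt_zero hTD ?_ ht
  · have h00 : (0 : ℝ) ∈ Icc 0 T := ⟨le_rfl, ht.1.trans ht.2⟩
    rw [h0, mul_inv_cancel₀ (hne 0 h00)] at h1
    exact (mul_inv_eq_one₀ (hne t ht)).1 h1
  · filter_upwards [hud, hvd, g.ae_notMem_C (Ico 0 T), ae_restrict_mem measurableSet_Ico]
      with s hs hs' hsC hsI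
    have hsI' := Ico_subset_Icc_self hsI
    simp only [← div_eq_mul_inv]
    refine hs.div_eq_zero hsC ?_ (hne s hsI') hs'
    by_cases hD : s ∈ g.D
    · exact hreg s ⟨hsI', hD⟩
    · rw [jump_eq_zero hD]
      simp

theorem toComplex_eq_map (z : 𝕜) : toComplex z = RCLike.map 𝕜 ℂ z := by
  simp [toComplex, RCLike.map_apply, mul_comm]

theorem map_toComplex (z : 𝕜) : RCLike.map ℂ 𝕜 (toComplex z) = z := by
  simp [toComplex, RCLike.map_apply]

theorem toComplex_mul (z w : 𝕜) : toComplex (z * w) = toComplex z * toComplex w := by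
  apply Complex.ext <;> simp [toComplex]

theorem toComplex_one_add_mul (z : 𝕜) (r : ℝ) :
    toComplex (1 + z * (r : 𝕜)) = 1 + toComplex z * (r : ℂ) := by
  apply Complex.ext <;> simp [toComplex]

theorem MemBD.toComplex {g : Derivator} {a b : ℝ} {β : ℝ → 𝕜} (hβ : g.MemBD a b β) :
    g.MemBD a b (fun s => toComplex (β s)) := by
  simp only [toComplex_eq_map]
  exact hβ.comp_continuous (RCLike.map 𝕜 ℂ).continuous

theorem Regressive.toComplex {g : Derivator} {a b : ℝ} {β : ℝ → 𝕜} (hβ : g.Regressive a b β) :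
    g.Regressive a b (fun s => toComplex (β s)) := by
  intro t ht h
  have h1 : Derivator.toComplex (1 + β t * ((g.jump t : ℝ) : 𝕜)) = 0 := by
    rw [toComplex_one_add_mul]
    exact h
  apply hβ t ht
  rw [← map_toComplex (1 + β t * ((g.jump t : ℝ) : 𝕜)), h1, map_zero]

theorem LipschitzWrt.clm {𝕜' : Type*} [RCLike 𝕜'] {g : Derivator} {a b K : ℝ} {f : ℝ → 𝕜}
    (hf : g.LipschitzWrt a b K f) (A : 𝕜 →L[ℝ] 𝕜') :
    g.LipschitzWrt a b (‖A‖ * K) (fun t => A (f t)) := by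
  intro x hx y hy hxy
  rw [← map_sub, mul_assoc]
  exact (A.le_opNorm _).trans (mul_le_mul_of_nonneg_left (hf x hx y hy hxy) (norm_nonneg _))

/-- The `g`-exponential of a `𝕜`-valued function is `𝕜`-valued. -/
theorem toComplex_map_gExp {g : Derivator} {T : ℝ} (hTD : T ∉ g.D) {β : ℝ → 𝕜}
    (hβ : g.MemBD 0 T β) (hreg : g.Regressive 0 T β) {t : ℝ} (ht : t ∈ Icc 0 T) :
    toComplex (RCLike.map ℂ 𝕜 (g.gExp (fun s => toComplex (β s)) t)) =
      g.gExp (fun s => toComplex (β s)) t := by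
  set p : ℝ → ℂ := fun s => toComplex (β s) with hp
  rcases RCLike.I_eq_zero_or_im_I_eq_one (K := 𝕜) with hI | hI
  -- Real scalars: the logarithms have imaginary part `π` where `1 + β Δg < 0`, so reality is not
  -- visible in the exponent. But the conjugate of the exponential solves the same problem, and
  -- complex uniqueness identifies the two.
  · have him : ∀ z : 𝕜, RCLike.im z = 0 := fun z => by
      rw [← RCLike.re_add_im z, hI]
      simp
    obtain ⟨⟨c, hc, hcV⟩, K, hK⟩ := gExp_bounds hβ.toComplex
    have hd := ae_of_forall fun t ht hC => hasDerivAt_gExp hβ.toComplex hreg.toComplex ht hC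
    have hd' : ∀ᵐ t ∂(g.measure.restrict (Ico 0 T)), g.HasDerivAt 0 T
        (fun t => Complex.conjCLE (g.gExp p t)) (p t * Complex.conjCLE (g.gExp p t)) t := by
      filter_upwards [hd, g.ae_notMem_C (Ico 0 T)] with s hs hsC
      have h1 := hs.clm hsC (Complex.conjCLE : ℂ →L[ℝ] ℂ)
      have h2 : Complex.conjCLE (p s * g.gExp p s) = p s * Complex.conjCLE (g.gExp p s) := by
        change (starRingEnd ℂ) (p s * g.gExp p s) = p s * (starRingEnd ℂ) (g.gExp p s)
        rw [map_mul, Complex.conj_eq_iff_im.2 (show (p s).im = 0 by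
          simp [hp, Derivator.toComplex, him])]
      rw [← h2]
      exact h1
    have h1 := AbsCont.eqOn_of_hasDerivAt hTD hreg.toComplex
      (hK.clm (Complex.conjCLE : ℂ →L[ℝ] ℂ)).absCont hK hc hcV hd' hd (by simp [gExp_zero]) ht
    have h2 : (g.gExp p t).im = 0 := Complex.conj_eq_iff_im.1 h1
    apply Complex.ext <;> simp [Derivator.toComplex, RCLike.map_apply, hI, h2]
  · apply Complex.ext <;> simp [Derivator.toComplex, RCLike.map_apply, hI]

theorem exists_solution {g : Derivator} {T : ℝ} (hTD : T ∉ g.D) {β : ℝ → 𝕜}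
    (hβ : g.MemBD 0 T β) (hreg : g.Regressive 0 T β) :
    ∃ v : ℝ → 𝕜, v 0 = 1 ∧ (∃ K, g.LipschitzWrt 0 T K v) ∧
      (∃ c > 0, ∀ t ∈ Icc 0 T, c ≤ ‖v t‖) ∧
      (∀ t ∈ Icc 0 T, t ∉ g.C → g.HasDerivAt 0 T v (β t * v t) t) ∧
      ∀ t ∈ Icc 0 T, toComplex (v t) = g.gExp (fun s => toComplex (β s)) t := by
  obtain ⟨⟨c, hc, hcV⟩, K, hK⟩ := gExp_bounds hβ.toComplex
  have hv := fun t ht => toComplex_map_gExp hTD hβ hreg (t := t) ht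
  refine ⟨fun t => RCLike.map ℂ 𝕜 (g.gExp (fun s => toComplex (β s)) t), ?_, ⟨_, hK.clm _⟩,
    ⟨c / (‖RCLike.map 𝕜 ℂ‖ + 1), by positivity, fun t ht => ?_⟩, fun t ht hC => ?_, hv⟩
  · simp [gExp_zero, RCLike.map_apply]
  · have h1 := hcV t ht
    rw [← hv t ht, toComplex_eq_map] at h1
    rw [div_le_iff₀ (by positivity), mul_comm]
    refine h1.trans (((RCLike.map 𝕜 ℂ).le_opNorm _).trans ?_)
    exact mul_le_mul_of_nonneg_right (by linarith) (norm_nonneg _)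
  · have h1 := (hasDerivAt_gExp hβ.toComplex hreg.toComplex ht hC).clm hC (RCLike.map ℂ 𝕜)
    have h2 : RCLike.map ℂ 𝕜 (toComplex (β t) * g.gExp (fun s => toComplex (β s)) t) =
        β t * RCLike.map ℂ 𝕜 (g.gExp (fun s => toComplex (β s)) t) := by
      rw [← hv t ht, ← toComplex_mul, map_toComplex, map_toComplex]
    rwa [h2] at h1

/-! ### Solutions in `BD¹_g` and the kernel of the derivative -/

theorem hasDerivAt_star {g : Derivator} {T t : ℝ} (hgT : T ∉ g.Nplus ∪ g.D ∪ g.C) {f φ : ℝ → 𝕜}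
    (h : ∀ t ∈ Icc 0 T, t ∉ g.C → g.HasDerivAt 0 T f (φ t) t) (ht : t ∈ Icc 0 T) :
    g.HasDerivAt 0 T f (φ (g.star t)) t := by
  by_cases hC : t ∈ g.C
  · exact hasDerivAt_of_star hC (star_notMem_C hgT ht.2)
      (h _ (star_mem_Icc hgT ht) (star_notMem_C hgT ht.2))
  · rw [star_of_notMem hC]
    exact h t ht hC

theorem memBD1_of_hasDerivAt {g : Derivator} {T : ℝ} (hgT : T ∉ g.Nplus ∪ g.D ∪ g.C)
    {f φ : ℝ → 𝕜} (hf : g.MemBD 0 T f) (hφ : g.MemBD 0 T φ)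
    (h : ∀ t ∈ Icc 0 T, t ∉ g.C → g.HasDerivAt 0 T f (φ t) t) : g.MemBD1 0 T f :=
  ⟨hf, _, fun _ ht => hasDerivAt_star hgT h ht, hφ.comp_star hgT⟩

theorem memKer_of_hasDerivAt {g : Derivator} {T : ℝ} (hgT : T ∉ g.Nplus ∪ g.D ∪ g.C)
    {f : ℝ → 𝕜} (hf : g.MemBD 0 T f)
    (h : ∀ t ∈ Icc 0 T, t ∉ g.C → g.HasDerivAt 0 T f 0 t) : g.MemKer 0 T f :=
  ⟨memBD1_of_hasDerivAt hgT hf (g.memBD_const 0 T 0) h,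
    fun _ ht => hasDerivAt_star (φ := fun _ => 0) hgT h ht⟩

/-- The difference between `f` and the integral of `φ` is Lipschitz with zero derivative a.e., hence
constant. -/
theorem LipschitzWrt.isPrimitive {g : Derivator} {T K : ℝ} (hTD : T ∉ g.D) {f φ : ℝ → 𝕜}
    (hf : g.LipschitzWrt 0 T K f) (hφ : g.MemBD 0 T φ)
    (h : ∀ t ∈ Icc 0 T, t ∉ g.C → g.HasDerivAt 0 T f (φ t) t) : g.IsPrimitive 0 T f φ := by
  have hP := isPrimitive_integral hφ.integrableOn
  obtain ⟨M, hM⟩ := hφ.1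
  set P : ℝ → 𝕜 := fun t => ∫ s in Ico 0 t, φ s ∂g.measure
  have hL : g.LipschitzWrt 0 T (K + M) (fun t => f t - P t) := by
    intro x hx y hy hxy
    have e : f y - P y - (f x - P x) = (f y - f x) - (P y - P x) := by ring
    beta_reduce
    rw [e, add_mul]
    exact (_root_.norm_sub_le _ _).trans
      (add_le_add (hf x hx y hy hxy) (hP.lipschitzWrt hM x hx y hy hxy))
  have hd : ∀ᵐ t ∂(g.measure.restrict (Ico 0 T)), g.HasDerivAt 0 T (fun t => f t - P t) 0 t := by
    refine ae_of_forall fun t ht hC => ?_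
    rw [← sub_self (φ t)]
    exact (h t ht hC).sub hC
      (hP.hasDerivAt hφ.integrableOn hM ht hC fun hD => hφ.contBetween ht hC hD)
  intro x hx y hy hxy
  have h1 := hL.absCont.eq_of_hasDerivAt_zero hTD hd hx
  have h2 := hL.absCont.eq_of_hasDerivAt_zero hTD hd hy
  rw [← hP x hx y hy hxy]
  linear_combination h2 - h1

-- Values of `g` up to `τ` and beyond `τ` are at least `Δg(τ)` apart, so `g`-continuity away from
-- `τ` does not see the step. At `τ` the space `BD_g` imposes no continuity, and the derivative uses
-- only `s > τ`, where the function equals its value at `τ`.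
open Classical in
theorem memKer_step {g : Derivator} {T τ : ℝ} (hgT : T ∉ g.Nplus ∪ g.D ∪ g.C) (hτ : τ ∈ g.D)
    (c d : 𝕜) : g.MemKer 0 T (fun t => if t < τ then c else d) := by
  have hgap : ∀ s t, s ≤ τ → τ < t → g.jump τ ≤ g t - g s := fun s t hs ht =>
    (g.jump_le ht).trans (by linarith [g.monotone' hs])
  refine memKer_of_hasDerivAt hgT ⟨⟨max ‖c‖ ‖d‖, fun t _ => ?_⟩, fun t ht ε hε => ?_,
    fun t ht ε hε => ?_, fun t ht ε hε => ?_⟩ fun t ht hC => ?_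
  · beta_reduce
    split_ifs
    · exact le_max_left _ _
    · exact le_max_right _ _
  · rcases lt_trichotomy t τ with h | h | h
    -- The value at `τ` is already `d` although `g τ` precedes the jump, so the gap to exploit on
    -- the left is `g τ - g t`.
    · have hlt : g t < g τ := lt_of_notMem_Nminus (fun hC => ht.2 (Or.inl (Or.inl hC)))
        (fun hN => ht.2 (Or.inl (Or.inr (Or.inl hN)))) h
      refine ⟨g τ - g t, sub_pos.2 hlt, fun s _ hs => ?_⟩
      have hsτ : s < τ := by
        by_contra! hle
        rw [abs_sub_comm] at hs
        linarith [le_abs_self (g s - g t), g.monotone' hle]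
      simpa [h, hsτ] using hε
    · exact absurd (Or.inr (h ▸ hτ)) ht.2
    · refine ⟨g.jump τ, hτ, fun s _ hs => ?_⟩
      have hsτ : ¬ s < τ := fun hlt => by
        linarith [le_abs_self (g t - g s), hgap s t hlt.le h]
      simpa [h.not_gt, hsτ] using hε
  · refine ⟨g.jump τ, hτ, fun s _ hst hs => ?_⟩
    rcases lt_trichotomy t τ with h | h | h
    · simpa [h, hst.trans h] using hε
    · exact absurd (h ▸ hτ) (mem_Nminus_iff.1 ht.2).2.1
    · have hsτ : ¬ s < τ := fun hlt => by linarith [hgap s t hlt.le h]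
      simpa [h.not_gt, hsτ] using hε
  · obtain ⟨hC, hD, -⟩ := mem_Nplus_iff.1 ht.2
    rcases lt_trichotomy t τ with h | h | h
    · have hlt : g t < g τ := lt_of_notMem_Nminus hC (notMem_Nminus_of_mem_Nplus ht.2) h
      refine ⟨g τ - g t, sub_pos.2 hlt, fun s _ _ hs => ?_⟩
      have hsτ : s < τ := by
        by_contra! hle
        linarith [g.monotone' hle]
      simpa [h, hsτ] using hε
    · exact absurd (h ▸ hτ) hD
    · exact ⟨1, one_pos, fun s _ hst _ => by simpa [h.not_gt, (h.trans hst).not_gt] using hε⟩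
  · rw [hasDerivAt_iff hC]
    refine tendsto_const_nhds.congr' ?_
    have h1 : ∀ᶠ s in g.derivFilter 0 T t, (s < τ ↔ t < τ) := by
      rcases lt_trichotomy t τ with h | h | h
      · filter_upwards [mem_nhdsWithin_of_mem_nhds (Iio_mem_nhds h)] with s hs
        exact iff_of_true hs h
      · filter_upwards [g.eventually_derivFilter_mem 0 T t] with s hs
        have := hs.2.1 (h ▸ hτ)
        exact iff_of_false (by linarith) (by linarith)
      · filter_upwards [mem_nhdsWithin_of_mem_nhds (Ioi_mem_nhds h)] with s hs
        exact iff_of_false (not_lt.2 (le_of_lt hs)) h.not_gt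
    filter_upwards [h1] with s hs
    simp only [hs, sub_self, zero_div]

/-- The solutions in `BD¹_g` are the products of `v` with functions in the kernel of `∂_g`. -/
theorem memBD1_isSolution_iff {g : Derivator} {T c : ℝ} (hT : 0 < T) (hg0 : (0 : ℝ) ∉ g.Nminus)
    (hgT : T ∉ g.Nplus ∪ g.D ∪ g.C) {β v : ℝ → 𝕜} (hβ : g.MemBD 0 T β)
    (hreg : g.Regressive 0 T β) (hv : g.MemBD 0 T v) (hv0 : v 0 = 1) (hc : 0 < c)
    (hvc : ∀ t ∈ Icc 0 T, c ≤ ‖v t‖)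
    (hvd : ∀ t ∈ Icc 0 T, t ∉ g.C → g.HasDerivAt 0 T v (β t * v t) t) (w : ℝ → 𝕜) :
    (g.MemBD1 0 T w ∧ g.IsSolution T β w) ↔
      ∃ h : ℝ → 𝕜, g.MemKer 0 T h ∧ h 0 = 1 ∧ EqOn w (fun t => h t * v t) (Icc 0 T) := by
  have hTD : T ∉ g.D := fun h => hgT (Or.inl (Or.inr h))
  have h00 : (0 : ℝ) ∈ Icc 0 T := ⟨le_rfl, hT.le⟩
  have hne : ∀ t ∈ Icc 0 T, v t ≠ 0 := fun t ht => norm_pos_iff.1 (hc.trans_le (hvc t ht))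
  have hF : ∀ t ∈ Icc 0 T, t ∉ g.C → NeBot (g.derivFilter 0 T t) :=
    fun t ht hC => neBot_derivFilter hT hg0 hgT ht hC
  constructor
  · rintro ⟨⟨hw, w', hw', hw'BD⟩, hsol, hw0⟩
    have hae : ∀ᵐ t ∂(g.measure.restrict (Ico 0 T)), w' t - β t * w t = 0 := by
      filter_upwards [hsol, g.ae_notMem_C (Ico 0 T), ae_restrict_mem measurableSet_Ico]
        with t ht htC htI
      have htI' := Ico_subset_Icc_self htI
      exact sub_eq_zero.2 ((hw' t htI').unique htC (hF t htI' htC) ht)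
    -- Upgrades the equation from a.e. to every point off `C_g`, as `w' - β w` is in `BD_g`.
    have hwd : ∀ t ∈ Icc 0 T, t ∉ g.C → g.HasDerivAt 0 T w (β t * w t) t := by
      intro t ht hC
      have h1 := (hw'BD.sub (hβ.mul hw)).eq_zero_of_ae hTD hae ht hC (hF t ht hC)
      rw [← sub_eq_zero.1 h1]
      exact hw' t ht
    refine ⟨fun t => w t / v t, memKer_of_hasDerivAt hgT ?_ fun t ht hC => ?_, ?_, fun t ht => ?_⟩
    · simp only [div_eq_mul_inv]
      exact hw.mul (hv.inv hc hvc)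
    · refine (hwd t ht hC).div_eq_zero hC ?_ (hne t ht) (hvd t ht hC)
      by_cases hD : t ∈ g.D
      · exact hreg t ⟨ht, hD⟩
      · rw [jump_eq_zero hD]
        simp
    · simp [hw0, hv0]
    · exact (div_mul_cancel₀ _ (hne t ht)).symm
  · rintro ⟨h, ⟨⟨hh, -⟩, hh'⟩, hh0, hw⟩
    have hwd : ∀ t ∈ Icc 0 T, t ∉ g.C → g.HasDerivAt 0 T w (β t * w t) t := by
      intro t ht hC
      refine HasDerivAt.congr hC ht hw.symm ?_
      -- Since `h` has zero derivative, the jump term of the product rule drops out and `h β v`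
      -- remains.
      convert (hh' t ht).mul hC (hvd t ht hC) using 1
      rw [hw ht]
      ring
    have hwBD : g.MemBD 0 T w := (hh.mul hv).congr hw.symm
    exact ⟨memBD1_of_hasDerivAt hgT hwBD (hβ.mul hwBD) hwd, ae_of_forall hwd,
      by simp [hw h00, hh0, hv0]⟩

end Derivator

theorem mainTheorem11 {𝕜 : Type*} [RCLike 𝕜] (g : Derivator) (T : ℝ) (hT : 0 < T)
    (hg0 : (0 : ℝ) ∉ g.Nminus) (hgT : T ∉ g.Nplus ∪ g.D ∪ g.C)
    (β : ℝ → 𝕜) (hβ : g.MemBD 0 T β) (hreg : g.Regressive 0 T β) :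
    ∃ v : ℝ → 𝕜,
      -- `v` is the unique `g`-absolutely continuous solution
      g.AbsCont 0 T v ∧ g.IsSolution T β v ∧
      (∀ u : ℝ → 𝕜, g.AbsCont 0 T u → g.IsSolution T β u → EqOn u v (Icc 0 T)) ∧
      -- it lies in `W^{1,1}_g ∩ BD¹_g` and is the `g`-exponential of `β`
      g.MemW11 0 T v ∧ g.MemBD1 0 T v ∧
      (∀ t ∈ Icc 0 T,
        Derivator.toComplex (v t) = g.gExp (fun s => Derivator.toComplex (β s)) t) ∧
      -- the solutions in `BD¹_g` are exactly the products `h · v`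
      (∀ w : ℝ → 𝕜, (g.MemBD1 0 T w ∧ g.IsSolution T β w) ↔
        ∃ h : ℝ → 𝕜, g.MemKer 0 T h ∧ h 0 = 1 ∧ EqOn w (fun t => h t * v t) (Icc 0 T)) ∧
      -- and there are others than `v` as soon as `g` jumps inside the interval
      ((g.D ∩ Ioo 0 T).Nonempty →
        ∃ w : ℝ → 𝕜, g.MemBD1 0 T w ∧ g.IsSolution T β w ∧ ¬ EqOn w v (Icc 0 T)) := by
  classical
  have hTD : T ∉ g.D := fun h => hgT (Or.inl (Or.inr h))
  obtain ⟨v, hv0, ⟨K, hK⟩, ⟨c, hc, hvc⟩, hvd, hvE⟩ := Derivator.exists_solution hTD hβ hreg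
  have hvBD := hK.memBD
  have hae := Derivator.ae_of_forall hvd
  have hiff := Derivator.memBD1_isSolution_iff hT hg0 hgT hβ hreg hvBD hv0 hc hvc hvd
  refine ⟨v, hK.absCont, ⟨hae, hv0⟩, fun u hu hus => ?_, ⟨hvBD.integrableOn, _,
    (hβ.mul hvBD).integrableOn, hK.isPrimitive hTD (hβ.mul hvBD) hvd⟩,
    Derivator.memBD1_of_hasDerivAt hgT hvBD (hβ.mul hvBD) hvd, hvE, hiff, ?_⟩
  · exact hu.eqOn_of_hasDerivAt hTD hreg hK hc hvc hus.1 hae (hus.2.trans hv0.symm)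
  · rintro ⟨τ, hτ, hτ0, hτT⟩
    -- The step is `1` at `0` because `τ > 0`, which preserves the initial value; at `τ` it doubles
    -- `v τ ≠ 0`.
    obtain ⟨h1, h2⟩ := (hiff (fun t => (if t < τ then 1 else 2) * v t)).2
      ⟨_, Derivator.memKer_step hgT hτ 1 2, by simp [hτ0], fun _ _ => rfl⟩
    refine ⟨_, h1, h2, fun heq => ?_⟩
    have hτI : τ ∈ Icc 0 T := ⟨hτ0.le, hτT.le⟩
    have h3 := heq hτI
    simp only [lt_irrefl, if_false] at h3
    have h4 : v τ = 0 := by linear_combination h3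
    have h5 := hvc τ hτI
    rw [h4, norm_zero] at h5
    exact absurd hc (not_lt.2 h5)
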